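/- Let $m\ge 0$ and $\theta\in\mathbb R$ with $|\theta|<\pi/2$. Let $\alpha_k=\begin{pmatrix}0&\sigma_k\\ \sigma_k&0\end{pmatrix}$ ($k=1,2,3$) be the standard $4\times4$ Dirac matrices, where $\sigma_k$ are the Pauli matrices. In the Hilbert space $L^2(\mathbb R)^4$ (complex valued, scalar product $(\cdot,\cdot)$ antilinear in the first argument) consider the operator $$H_\theta := -i\alpha_1 e^{-i\theta/2}\partial_x-\alpha_2 e^{i\theta/2}x+m\alpha_3,\qquad \mathsf D(H_\theta):=\mathcal D^4,\qquad \mathcal D:=H^1(\mathbb R)\cap L^2(\mathbb R,x^2\,dx).$$ For $n\ge 0$ let $\phi_n(z):=i^n\,(2^n n!\sqrt\pi)^{-1/2}\,\mathsf H_n(z)\,e^{-z^2/2}$ ($z\in\mathbb C$) be the normalised Hermite functions ($\mathsf H_n$ being the physicists' Hermite polynomials), and put $\varphi_n^{\theta}(x):=e^{i\theta/4}\phi_n(e^{i\theta/2}x)$, $x\in\mathbb R$; this function is in $L^2(\mathbb R)$. Write $E_n:=\sqrt{2n+m^2}$. For $n\ge1$ let $u_n^1,\dots,u_n^4\in\mathbb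 C^4$ be the vectors $$(\sqrt{2n},E_n-m,\sqrt{2n},E_n-m),\quad(-\sqrt{2n},E_n+m,\sqrt{2n},-E_n-m),$$ $$(-\sqrt{2n},E_n+m,-\sqrt{2n},E_n+m),\quad(\sqrt{2n},E_n-m,-\sqrt{2n},-E_n+m),$$ each divided by its Euclidean norm. Define $$\chi_0^{1}:=\tfrac1{\sqrt2}(\varphi_0^\theta,0,\varphi_0^\theta,0)^\top,\qquad \chi_0^{2}:=\tfrac1{\sqrt2}(\varphi_0^\theta,0,-\varphi_0^\theta,0)^\top,$$ $$\chi_n^j:=\big((u^j_n)_1\varphi_n^\theta,(u^j_n)_2\varphi_{n-1}^\theta,(u^j_n)_3\varphi_n^\theta,(u^j_n)_4\varphi_{n-1}^\theta\big)^\top\qquad(n\ge1,\ j=1,\dots,4),$$ and let $\tilde\chi_n^j$ be the same functions with $\theta$ replaced by $-\theta$. Attach to $\chi_0^1$ and $\chi_0^2$ the numbers $\lambda_0^1:=m$ and $\lambda_0^2:=-m$, and for $n\ge1$ attach to $\chi_n^j$ the number $\lambda_n^j:=E_n$ if $j\in\{1,2\}$ and $\lambda_n^j:=-E_n$ if $j\in\{3,4\}$.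 Then: 1. $\sigma(H_\theta)=\{-\sqrt{2n+m^2},\,\sqrt{2n+m^2}\}_{n=0}^{\infty}$. 2. $\chi_n^j\in\mathsf D(H_\theta)$ and $H_\theta\chi_n^j=\lambda_n^j\chi_n^j$ for all admissible $(n,j)$, and for every $\lambda\in\mathbb C$ one has $\ker(H_\theta-\lambda)=\operatorname{span}\{\chi_n^j:\lambda_n^j=\lambda\}$. The geometric multiplicity of $\pm\sqrt{2n+m^2}$ is $2$ for each $n\ge1$; that of $\pm m$ is $1$ if $m>0$; that of $0$ is $2$ if $m=0$. 3. Every eigenvalue is semisimple: for every $\lambda\in\sigma(H_\theta)$ the root subspace $\bigcup_{k}\ker(H_\theta-\lambda)^k$ equals $\ker(H_\theta-\lambda)$, so the algebraic multiplicity (the dimension of the root subspace) equals the geometric multiplicity. 4. $\tilde\chi_n^j\in\mathsf D(H_{-\theta})$ and $H_{-\theta}\tilde\chi_n^j=\lambda_n^j\tilde\chi_n^j$, and the two families are biorthonormal: $(\tilde\chi_n^i,\chi_{n'}^j)=\delta_{ij}\delta_{nn'}$ for all admissible $(n,i)$, $(n',j)$. -/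

import Mathlib

open MeasureTheory Complex
open scoped ContDiff InnerProductSpace

noncomputable section

/-! ### Unbounded operators -/

section Unbounded

variable {E : Type*} [NormedAddCommGroup E] [NormedSpace ℂ E]

/-- `z` lies in the resolvent set of `T`: `T - z` is a bijection of the domain of `T` onto the
whole space, with a bounded inverse `R`. -/
def MemResolventSet (T : E →ₗ.[ℂ] E) (z : ℂ) : Prop :=
  ∃ R : E →L[ℂ] E,
    (∀ v : E, ∃ h : R v ∈ T.domain, T ⟨R v, h⟩ - z • R v = v) ∧
    (∀ u : T.domain, R (T u - z • (u : E)) = u)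

/-- The spectrum of the unbounded operator `T`: the complement of the resolvent set. -/
def unboundedSpectrum (T : E →ₗ.[ℂ] E) : Set ℂ :=
  {z | ¬ MemResolventSet T z}

/-- `genEigenspace T z k` is the kernel of `(T - z) ^ k`, on the natural domain of that power. -/
def genEigenspace (T : E →ₗ.[ℂ] E) (z : ℂ) : ℕ → Submodule ℂ E
  | 0 => ⊥
  | k + 1 =>
    ((genEigenspace T z k).comap (T.toFun - z • T.domain.subtype)).map T.domain.subtype

/-- The eigenspace `ker (T - z)` (it is trivial when `z` is not an eigenvalue). -/
def eigenspaceOf (T : E →ₗ.[ℂ] E) (z : ℂ) : Submodule ℂ E :=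
  (LinearMap.ker (T.toFun - z • T.domain.subtype)).map T.domain.subtype

/-- The root subspace `⋃ₖ ker (T - z) ^ k`. -/
def rootSubspace (T : E →ₗ.[ℂ] E) (z : ℂ) : Submodule ℂ E :=
  ⨆ k : ℕ, genEigenspace T z k

/-- The geometric multiplicity of `z`. -/
def geomMultiplicity (T : E →ₗ.[ℂ] E) (z : ℂ) : Cardinal :=
  Module.rank ℂ (eigenspaceOf T z)

/-- The algebraic multiplicity of `z`. -/
def algMultiplicity (T : E →ₗ.[ℂ] E) (z : ℂ) : Cardinal :=
  Module.rank ℂ (rootSubspace T z)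

end Unbounded

/-! ### The space `L²(ℝ)⁴` and the form domain -/

/-- `L²(ℝ)`, complex valued. -/
abbrev L2R : Type := Lp ℂ 2 (volume : Measure ℝ)

/-- The Hilbert space `L²(ℝ)⁴`. -/
abbrev L2R4 : Type := PiLp 2 (fun _ : Fin 4 => L2R)

/-- `g` is the weak derivative of `u` on `ℝ`. -/
def IsWeakDeriv (u g : L2R) : Prop :=
  ∀ φ : ℝ → ℝ, ContDiff ℝ ∞ φ → HasCompactSupport φ →
    ∫ x, deriv φ x • u x = - ∫ x, φ x • g x

/-- `g` is the function `x ↦ x * u x`. -/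
def IsMulX (u g : L2R) : Prop :=
  ∀ᵐ x : ℝ, g x = (x : ℂ) * u x

lemma L2R.integrable_smul (u : L2R) {φ : ℝ → ℝ} (hφ : Continuous φ) (hc : HasCompactSupport φ) :
    Integrable (fun x => φ x • u x) := by
  have hu : LocallyIntegrable (fun x => u x) volume :=
    (Lp.memLp u).locallyIntegrable (by norm_num)
  exact hu.integrable_smul_left_of_hasCompactSupport hφ hc

lemma IsWeakDeriv.unique {u g g' : L2R} (h : IsWeakDeriv u g) (h' : IsWeakDeriv u g') :
    g = g' := by
  apply Lp.ext
  refine ae_eq_of_integral_contDiff_smul_eq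
    ((Lp.memLp g).locallyIntegrable (by norm_num))
    ((Lp.memLp g').locallyIntegrable (by norm_num)) ?_
  intro φ hφ hc
  have h1 := h φ hφ hc
  have h2 := h' φ hφ hc
  exact neg_injective (h1.symm.trans h2)

lemma IsWeakDeriv.add {u v g k : L2R} (h : IsWeakDeriv u g) (h' : IsWeakDeriv v k) :
    IsWeakDeriv (u + v) (g + k) := by
  intro φ hφ hc
  have hd : Continuous (deriv φ) := hφ.continuous_deriv (by simp)
  have e1 : ∫ x, deriv φ x • (u + v : L2R) x
      = ∫ x, (deriv φ x • u x + deriv φ x • v x) := by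
    refine integral_congr_ae ?_
    filter_upwards [Lp.coeFn_add u v] with x hx
    rw [hx, Pi.add_apply, smul_add]
  have e2 : ∫ x, φ x • (g + k : L2R) x = ∫ x, (φ x • g x + φ x • k x) := by
    refine integral_congr_ae ?_
    filter_upwards [Lp.coeFn_add g k] with x hx
    rw [hx, Pi.add_apply, smul_add]
  rw [e1, e2, integral_add (u.integrable_smul hd hc.deriv) (v.integrable_smul hd hc.deriv),
    integral_add (g.integrable_smul hφ.continuous hc) (k.integrable_smul hφ.continuous hc),
    h φ hφ hc, h' φ hφ hc, neg_add]

lemma IsWeakDeriv.smul (c : ℂ) {u g : L2R} (h : IsWeakDeriv u g) :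
    IsWeakDeriv (c • u) (c • g) := by
  intro φ hφ hc
  have e1 : ∫ x, deriv φ x • (c • u : L2R) x = ∫ x, c • (deriv φ x • u x) := by
    refine integral_congr_ae ?_
    filter_upwards [Lp.coeFn_smul c u] with x hx
    rw [hx, Pi.smul_apply, smul_comm]
  have e2 : ∫ x, φ x • (c • g : L2R) x = ∫ x, c • (φ x • g x) := by
    refine integral_congr_ae ?_
    filter_upwards [Lp.coeFn_smul c g] with x hx
    rw [hx, Pi.smul_apply, smul_comm]
  rw [e1, e2, integral_smul, integral_smul, h φ hφ hc, smul_neg]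

lemma IsMulX.unique {u g g' : L2R} (h : IsMulX u g) (h' : IsMulX u g') : g = g' := by
  apply Lp.ext
  filter_upwards [h, h'] with x hx hx'
  rw [hx, hx']

lemma IsMulX.add {u v g k : L2R} (h : IsMulX u g) (h' : IsMulX v k) :
    IsMulX (u + v) (g + k) := by
  filter_upwards [h, h', Lp.coeFn_add u v, Lp.coeFn_add g k] with x h1 h2 h3 h4
  rw [h3, h4, Pi.add_apply, Pi.add_apply, h1, h2, mul_add]

lemma IsMulX.smul (c : ℂ) {u g : L2R} (h : IsMulX u g) : IsMulX (c • u) (c • g) := by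
  filter_upwards [h, Lp.coeFn_smul c u, Lp.coeFn_smul c g] with x h1 h3 h4
  rw [h3, h4, Pi.smul_apply, Pi.smul_apply, h1, smul_eq_mul, smul_eq_mul]
  ring

/-- The form domain `𝒟 = H¹(ℝ) ∩ L²(ℝ, x² dx)`: the `u` in `L²(ℝ)` whose weak derivative and
whose product with `x` are in `L²(ℝ)`. -/
def formDomain : Submodule ℂ L2R where
  carrier := {u | (∃ g, IsWeakDeriv u g) ∧ ∃ g, IsMulX u g}
  add_mem' := by
    rintro u v ⟨⟨g, hg⟩, g', hg'⟩ ⟨⟨k, hk⟩, k', hk'⟩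
    exact ⟨⟨_, hg.add hk⟩, _, hg'.add hk'⟩
  zero_mem' := by
    refine ⟨⟨0, ?_⟩, 0, ?_⟩
    · intro φ _ _
      have e1 : ∫ x, deriv φ x • (0 : L2R) x = 0 := by
        refine integral_eq_zero_of_ae ?_
        filter_upwards [Lp.coeFn_zero ℂ 2 (volume : Measure ℝ)] with x _
        simp
      have e2 : ∫ x, φ x • (0 : L2R) x = 0 := by
        refine integral_eq_zero_of_ae ?_
        filter_upwards [Lp.coeFn_zero ℂ 2 (volume : Measure ℝ)] with x _
        simp
      rw [e1, e2, neg_zero]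
    · filter_upwards [Lp.coeFn_zero ℂ 2 (volume : Measure ℝ)] with x _
      simp
  smul_mem' := by
    rintro c u ⟨⟨g, hg⟩, g', hg'⟩
    exact ⟨⟨_, hg.smul c⟩, _, hg'.smul c⟩

/-- The weak derivative `∂ₓ` as a linear map on `𝒟`. -/
def weakDeriv : formDomain →ₗ[ℂ] L2R where
  toFun u := u.2.1.choose
  map_add' u v :=
    (u + v).2.1.choose_spec.unique (u.2.1.choose_spec.add v.2.1.choose_spec)
  map_smul' c u :=
    (c • u).2.1.choose_spec.unique (u.2.1.choose_spec.smul c)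

/-- Multiplication by `x` as a linear map on `𝒟`. -/
def mulX : formDomain →ₗ[ℂ] L2R where
  toFun u := u.2.2.choose
  map_add' u v :=
    (u + v).2.2.choose_spec.unique (u.2.2.choose_spec.add v.2.2.choose_spec)
  map_smul' c u :=
    (c • u).2.2.choose_spec.unique (u.2.2.choose_spec.smul c)

lemma weakDeriv_spec (u : formDomain) : IsWeakDeriv u (weakDeriv u) := u.2.1.choose_spec

lemma mulX_spec (u : formDomain) : IsMulX u (mulX u) := u.2.2.choose_spec

/-! ### The Dirac operator -/

/-- The Dirac matrix `α₁` (off-diagonal blocks `σ₁`). -/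
def diracAlpha1 : Matrix (Fin 4) (Fin 4) ℂ :=
  !![0, 0, 0, 1; 0, 0, 1, 0; 0, 1, 0, 0; 1, 0, 0, 0]

/-- The Dirac matrix `α₂` (off-diagonal blocks `σ₂`). -/
def diracAlpha2 : Matrix (Fin 4) (Fin 4) ℂ :=
  !![0, 0, 0, -I; 0, 0, I, 0; 0, -I, 0, 0; I, 0, 0, 0]

/-- The Dirac matrix `α₃` (off-diagonal blocks `σ₃`). -/
def diracAlpha3 : Matrix (Fin 4) (Fin 4) ℂ :=
  !![0, 0, 1, 0; 0, 0, 0, -1; 1, 0, 0, 0; 0, -1, 0, 0]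

/-- `𝒟⁴` as a subspace of `L²(ℝ)⁴`. -/
def diracDomain : Submodule ℂ L2R4 where
  carrier := {Ψ | ∀ k, Ψ k ∈ formDomain}
  add_mem' h h' k := formDomain.add_mem (h k) (h' k)
  zero_mem' _ := formDomain.zero_mem
  smul_mem' c _ h k := formDomain.smul_mem c (h k)

/-- The `k`-th component of a spinor in `𝒟⁴`, as an element of `𝒟`. -/
def diracComponent (k : Fin 4) : diracDomain →ₗ[ℂ] formDomain where
  toFun Ψ := ⟨(Ψ : L2R4) k, Ψ.2 k⟩
  map_add' _ _ := rfl
  map_smul' _ _ := rfl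

/-- The operator
`H_θ = - i α₁ e^{-iθ/2} ∂ₓ - α₂ e^{iθ/2} x + m α₃` in `L²(ℝ)⁴`, with domain `𝒟⁴`. -/
def diracOp (θ m : ℝ) : L2R4 →ₗ.[ℂ] L2R4 where
  domain := diracDomain
  toFun :=
    (WithLp.linearEquiv 2 ℂ (Fin 4 → L2R)).symm.toLinearMap ∘ₗ LinearMap.pi fun k =>
      ∑ j : Fin 4,
        ((-I * diracAlpha1 k j * exp (-(I * θ / 2))) • (weakDeriv ∘ₗ diracComponent j)
          - (diracAlpha2 k j * exp (I * θ / 2)) • (mulX ∘ₗ diracComponent j)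
          + ((m : ℂ) * diracAlpha3 k j) • (formDomain.subtype ∘ₗ diracComponent j))

/-! ### Rotated Hermite functions -/

/-- The normalised Hermite function of degree `n`, with the phase `iⁿ`, as an entire function:
`iⁿ (2ⁿ n! √π)^{-1/2} Hₙ(z) exp (-z² / 2)`, where `Hₙ(z) = 2^{n/2} Heₙ(√2 z)` and `Heₙ` is
Mathlib's (probabilists') Hermite polynomial. -/
def hermiteFun (n : ℕ) (z : ℂ) : ℂ :=
  I ^ n * ((Real.sqrt (n.factorial * Real.sqrt Real.pi))⁻¹ : ℝ) *
    Polynomial.aeval ((Real.sqrt 2 : ℝ) * z) (Polynomial.hermite n) * exp (-z ^ 2 / 2)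

/-- The rotated Hermite function `x ↦ e^{iθ/4} φₙ(e^{iθ/2} x)`. -/
def rotHermiteFun (θ : ℝ) (n : ℕ) (x : ℝ) : ℂ :=
  exp (I * θ / 4) * hermiteFun n (exp (I * θ / 2) * x)

lemma memLp_pow_mul_gauss {a : ℂ} (ha : 0 < a.re) (n : ℕ) :
    MemLp (fun x : ℝ => (x : ℂ) ^ n * exp (-a * (x : ℂ) ^ 2)) 2 volume := by
  rw [memLp_two_iff_integrable_sq_norm (by fun_prop)]
  have h := integrable_rpow_mul_exp_neg_mul_sq (b := 2 * a.re) (by positivity)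
    (s := ((2 * n : ℕ) : ℝ)) (lt_of_lt_of_le (by norm_num) (Nat.cast_nonneg _))
  refine h.congr (Filter.Eventually.of_forall fun x => ?_)
  have e : (-a * (x : ℂ) ^ 2).re = -a.re * x ^ 2 := by
    rw [← ofReal_pow, re_mul_ofReal, neg_re]
  simp only [norm_mul, norm_pow, norm_real, norm_exp, e, Real.rpow_natCast, mul_pow]
  have e1 : (‖x‖ ^ n) ^ 2 = x ^ (2 * n) := by
    rw [← pow_mul, mul_comm n 2, pow_mul, pow_mul, Real.norm_eq_abs, sq_abs]
  rw [e1, ← Real.exp_nat_mul]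
  congr 2
  push_cast
  ring

lemma memLp_polynomial_mul_gauss {a : ℂ} (ha : 0 < a.re) (c : ℂ) (p : Polynomial ℤ) :
    MemLp (fun x : ℝ => Polynomial.aeval (c * x) p * exp (-a * (x : ℂ) ^ 2)) 2 volume := by
  induction p using Polynomial.induction_on' with
  | add p q hp hq =>
    refine (hp.add hq).ae_eq (Filter.Eventually.of_forall fun x => ?_)
    simp [add_mul]
  | monomial n k =>
    refine ((memLp_pow_mul_gauss ha n).const_mul ((k : ℂ) * c ^ n)).ae_eq
      (Filter.Eventually.of_forall fun x => ?_)
    simp [Polynomial.aeval_monomial, mul_pow]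
    ring

lemma memLp_rotHermiteFun {θ : ℝ} (hθ : |θ| < Real.pi / 2) (n : ℕ) :
    MemLp (rotHermiteFun θ n) 2 volume := by
  have ha : 0 < (exp (I * θ) / 2).re := by
    have : (exp (I * θ) / 2).re = Real.cos θ / 2 := by
      rw [mul_comm, exp_mul_I, ← ofReal_cos, ← ofReal_sin]
      simp [-ofReal_cos, -ofReal_sin]
    rw [this]
    have := Real.cos_pos_of_mem_Ioo (abs_lt.mp hθ)
    positivity
  refine ((memLp_polynomial_mul_gauss ha ((Real.sqrt 2 : ℝ) * exp (I * θ / 2))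
    (Polynomial.hermite n)).const_mul (exp (I * θ / 4) * (I ^ n *
      ((Real.sqrt (n.factorial * Real.sqrt Real.pi))⁻¹ : ℝ)))).ae_eq
      (Filter.Eventually.of_forall fun x => ?_)
  have e : -(exp (I * θ / 2) * x) ^ 2 / 2 = -(exp (I * θ) / 2) * (x : ℂ) ^ 2 := by
    rw [mul_pow, ← exp_nat_mul, show ((2 : ℕ) : ℂ) * (I * θ / 2) = I * θ by push_cast; ring]
    ring
  simp only [rotHermiteFun, hermiteFun, e, mul_assoc]

/-- The rotated Hermite function `φₙ` as an element of `L²(ℝ)`. -/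
def rotHermite {θ : ℝ} (hθ : |θ| < Real.pi / 2) (n : ℕ) : L2R :=
  (memLp_rotHermiteFun hθ n).toLp _

/-! ### The explicit eigenfunctions -/

/-- The eigenvalue `√(2n + m²)`. -/
def diracEnergy (m : ℝ) (n : ℕ) : ℝ := Real.sqrt (2 * n + m ^ 2)

/-- The coefficient vectors `u¹, u², u³, u⁴` for `n ≥ 1`, before normalisation. -/
def diracCoeffRaw (m : ℝ) (n : ℕ) : Fin 4 → EuclideanSpace ℝ (Fin 4) :=
  ![!₂[Real.sqrt (2 * n), diracEnergy m n - m, Real.sqrt (2 * n), diracEnergy m n - m],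
    !₂[-Real.sqrt (2 * n), diracEnergy m n + m, Real.sqrt (2 * n), -diracEnergy m n - m],
    !₂[-Real.sqrt (2 * n), diracEnergy m n + m, -Real.sqrt (2 * n), diracEnergy m n + m],
    !₂[Real.sqrt (2 * n), diracEnergy m n - m, -Real.sqrt (2 * n), -diracEnergy m n + m]]

/-- The coefficient vectors `u¹, u², u³, u⁴` for `n ≥ 1`, normalised in `ℂ⁴`. -/
def diracCoeff (m : ℝ) (n : ℕ) (j : Fin 4) : EuclideanSpace ℝ (Fin 4) :=
  ‖diracCoeffRaw m n j‖⁻¹ • diracCoeffRaw m n j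

/-- The labels of the eigenfunctions: `ground s` for level `0`, with `s = 0` for `+m` and `s = 1`
for `-m`; and `excited n j` for level `n + 1`, with `j = 0, 1` for `+√(2(n+1)+m²)` and
`j = 2, 3` for `-√(2(n+1)+m²)`. -/
inductive DiracLabel : Type
  | ground (s : Fin 2) : DiracLabel
  | excited (n : ℕ) (j : Fin 4) : DiracLabel

/-- The eigenvalue attached to a label. -/
def diracEigenvalue (m : ℝ) : DiracLabel → ℝ
  | .ground s => ![m, -m] s
  | .excited n j =>
    ![diracEnergy m (n + 1), diracEnergy m (n + 1),
      -diracEnergy m (n + 1), -diracEnergy m (n + 1)] j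

/-- The explicit eigenfunctions: `(φ₀, 0, ±φ₀, 0) / √2` at level `0`, and
`(u₁ φₙ, u₂ φₙ₋₁, u₃ φₙ, u₄ φₙ₋₁)`, `u = uʲ`, at level `n ≥ 1`. -/
def diracEigenfun {θ : ℝ} (hθ : |θ| < Real.pi / 2) (m : ℝ) : DiracLabel → L2R4
  | .ground s =>
    WithLp.toLp 2
      ![((Real.sqrt 2)⁻¹ : ℝ) • rotHermite hθ 0, 0,
        (![(Real.sqrt 2)⁻¹, -(Real.sqrt 2)⁻¹] s : ℝ) • rotHermite hθ 0, 0]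
  | .excited n j =>
    WithLp.toLp 2
      ![diracCoeff m (n + 1) j 0 • rotHermite hθ (n + 1),
        diracCoeff m (n + 1) j 1 • rotHermite hθ n,
        diracCoeff m (n + 1) j 2 • rotHermite hθ (n + 1),
        diracCoeff m (n + 1) j 3 • rotHermite hθ n]

/-- The functions obtained from `diracEigenfun` on replacing `θ` by `-θ`. -/
def diracEigenfunTilde {θ : ℝ} (hθ : |θ| < Real.pi / 2) (m : ℝ) : DiracLabel → L2R4 :=
  diracEigenfun (θ := -θ) (by rwa [abs_neg]) m

end

/-! ### Recurrences for the Hermite functions -/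

section HermiteFunctions

/-! In terms of the ladder operators `lowerOp θ` and `raiseOp θ`, the operator has off-diagonal
blocks equal to the 2×2 matrix with rows (m, raise) and (lower, -m). The rotation is built so that
its phases cancel on the rotated Hermite functions: lowering φₙ gives √(2n) φₙ₋₁ and raising gives
√(2(n+1)) φₙ₊₁, whatever θ is. Hence for n ≥ 1 each level spans a four-dimensional invariant space,
on which H_θ acts by a real symmetric matrix with square 2n + m²; the vectors uʲ diagonalise it
(`diracCoeff_eigen`). At level 0 lowering gives zero and only ±m remain.

Conjugation reverses the phases, so the formal adjoint of lowering at θ is raising at -θ. Moving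
ladder operators across the scalar product reduces biorthonormality to one complex Gaussian integral
(`inner_rotHermite_rotHermite`) and makes the functions at -θ eigenfunctions of the formal adjoint.

For θ ≠ 0 no orthonormal eigenbasis is at hand, and no eigenfunction expansion is used. Totality
suffices (`eq_zero_of_inner_rotHermite_eq_zero`, a moment argument). A vector in a root subspace is
annihilated by every dual eigenfunction with another eigenvalue; subtracting its finite biorthogonal
projection leaves a vector orthogonal to the whole dual system, that is, zero. This gives
eigenspaces and semisimplicity at once. If z is not an eigenvalue, totality of the dual system makes
H_θ - z injective, closedness and compactness upgrade this to a lower bound, so the range is closed,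
and totality of the eigenfunctions makes it dense (`BiorthonormalEigensystem.memResolventSet`).

Closedness and compactness rest on coercivity, `coercive_lowerOp` and `coercive_raiseOp`: the cross
term is e^{iθ}⟨u', xu⟩ up to sign, the real part of ⟨u', xu⟩ is exactly -‖u‖²/2, and its imaginary
part enters with the factor sin θ, of modulus below 1. -/

open Polynomial in
theorem derivative_hermite_succ (n : ℕ) :
    derivative (hermite (n + 1)) = (n + 1 : ℤ[X]) * hermite n := by
  induction n with
  | zero => simp
  | succ n ih =>
    rw [hermite_succ (n + 1), derivative_sub, ih, derivative_mul, derivative_mul, derivative_X,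
      ih, hermite_succ n]
    have : derivative (n + 1 : ℤ[X]) = 0 := by simp
    rw [this]
    push_cast
    ring

/-- The normalising constant `(n! √π)^{-1/2}` of the Hermite functions. -/
noncomputable def hermiteConst (n : ℕ) : ℝ := (Real.sqrt (n.factorial * Real.sqrt Real.pi))⁻¹

lemma sqrt_mul_hermiteConst_succ (n : ℕ) :
    Real.sqrt (n + 1) * hermiteConst (n + 1) = hermiteConst n := by
  have h : (0 : ℝ) < Real.sqrt (n + 1) := Real.sqrt_pos.2 (by positivity)
  have e : ((n + 1).factorial * Real.sqrt Real.pi : ℝ)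
      = (n + 1) * (n.factorial * Real.sqrt Real.pi) := by
    rw [Nat.factorial_succ]; push_cast; ring
  rw [hermiteConst, hermiteConst, e, Real.sqrt_mul (by positivity), mul_inv, ← mul_assoc,
    mul_inv_cancel₀ h.ne', one_mul]

lemma ofReal_sqrt_mul_self {x : ℝ} (hx : 0 ≤ x) :
    ((Real.sqrt x : ℝ) : ℂ) * (Real.sqrt x : ℝ) = x := by
  rw [← ofReal_mul, Real.mul_self_sqrt hx]

lemma natCast_mul_hermiteConst (n : ℕ) :
    ((n : ℂ) + 1) * (hermiteConst (n + 1) : ℝ) = (Real.sqrt (n + 1) : ℝ) * (hermiteConst n : ℝ) := by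
  rw [← sqrt_mul_hermiteConst_succ n, ofReal_mul, ← mul_assoc, ofReal_sqrt_mul_self (by positivity)]
  push_cast
  rfl

lemma hermiteFun_def (n : ℕ) (z : ℂ) :
    hermiteFun n z = I ^ n * (hermiteConst n : ℝ) *
      Polynomial.aeval ((Real.sqrt 2 : ℝ) * z) (Polynomial.hermite n) * exp (-z ^ 2 / 2) := rfl

lemma hermiteFun_zero (z : ℂ) : hermiteFun 0 z = (hermiteConst 0 : ℝ) * exp (-z ^ 2 / 2) := by
  simp [hermiteFun_def]

/-- The constant `i √(n/2)` in the recurrences of the Hermite functions. -/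
noncomputable def ladderConst (n : ℕ) : ℂ := I * (Real.sqrt (n / 2) : ℝ)

@[simp] lemma ladderConst_zero : ladderConst 0 = 0 := by simp [ladderConst]

lemma ladderConst_eq (n : ℕ) : ladderConst n * (Real.sqrt 2 : ℝ) = I * (Real.sqrt n : ℝ) := by
  rw [ladderConst, mul_assoc, ← ofReal_mul, ← Real.sqrt_mul (by positivity)]
  congr 3
  ring

lemma sqrt_two_ne : ((Real.sqrt 2 : ℝ) : ℂ) ≠ 0 := by
  rw [ofReal_ne_zero]; positivity

/-- The three-term recurrence of the polynomials after rescaling; the phase iⁿ makes both constants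
imaginary. For `n = 0` the truncated index `n - 1` is harmless because `ladderConst 0 = 0`. -/
lemma mul_hermiteFun (n : ℕ) (z : ℂ) :
    z * hermiteFun n z =
      ladderConst n * hermiteFun (n - 1) z - ladderConst (n + 1) * hermiteFun (n + 1) z := by
  have h2 := sqrt_two_ne
  refine mul_left_cancel₀ h2 ?_
  have e1 := ladderConst_eq n
  have e2 := ladderConst_eq (n + 1)
  set w : ℂ := (Real.sqrt 2 : ℝ) * z with hw
  have e3 : ((Real.sqrt 2 : ℝ) : ℂ) * (ladderConst n * hermiteFun (n - 1) z -
      ladderConst (n + 1) * hermiteFun (n + 1) z) =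
      I * (Real.sqrt n : ℝ) * hermiteFun (n - 1) z
        - I * (Real.sqrt (n + 1 : ℕ) : ℝ) * hermiteFun (n + 1) z := by
    rw [← e1, ← e2]; ring
  rw [e3, ← mul_assoc, ← hw]
  cases n with
  | zero =>
    have hc := sqrt_mul_hermiteConst_succ 0
    simp only [hermiteFun_def, ← hw, ← hc]
    simp
    linear_combination (w * hermiteConst 1 * exp (-z^2/2)) * I_sq
  | succ n =>
    have hc := sqrt_mul_hermiteConst_succ (n + 1)
    have hc' := natCast_mul_hermiteConst n
    have hH : Polynomial.aeval w (Polynomial.hermite (n + 2)) =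
        w * Polynomial.aeval w (Polynomial.hermite (n + 1)) -
          (n + 1) * Polynomial.aeval w (Polynomial.hermite n) := by
      rw [Polynomial.hermite_succ (n + 1), derivative_hermite_succ]
      simp
    have hc2 : ((Real.sqrt (n + 1 + 1) : ℝ) : ℂ) * (hermiteConst (n + 1 + 1) : ℝ)
        = (hermiteConst (n + 1) : ℝ) := by
      rw [← ofReal_mul, ← hc]; push_cast; rfl
    simp only [hermiteFun_def, ← hw, Nat.add_sub_cancel, hH]
    push_cast
    rw [pow_succ I (n + 1), pow_succ I n]
    linear_combination (exp (-z ^ 2 / 2)) * (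
      (I ^ n * I * Polynomial.aeval w (Polynomial.hermite n)) * hc'
      + I ^ n * I ^ 3 * (w * Polynomial.aeval w (Polynomial.hermite (n + 1)) -
          (n + 1) * Polynomial.aeval w (Polynomial.hermite n)) * hc2
      + (I ^ n * I * (hermiteConst (n + 1) : ℝ)) *
        (w * Polynomial.aeval w (Polynomial.hermite (n + 1)) -
          (n + 1) * Polynomial.aeval w (Polynomial.hermite n)) * I_sq)

lemma hasDerivAt_hermiteFun (n : ℕ) (z : ℂ) :
    HasDerivAt (hermiteFun n)
      (ladderConst n * hermiteFun (n - 1) z + ladderConst (n + 1) * hermiteFun (n + 1) z) z := by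
  -- This form matches the product rule: differentiating the polynomial gives the first term,
  -- differentiating the Gaussian gives -z.
  have e0 : ladderConst n * hermiteFun (n - 1) z + ladderConst (n + 1) * hermiteFun (n + 1) z
      = 2 * (ladderConst n * hermiteFun (n - 1) z) - z * hermiteFun n z := by
    rw [mul_hermiteFun]; ring
  have hp : HasDerivAt (fun z : ℂ => Polynomial.aeval ((Real.sqrt 2 : ℝ) * z)
      (Polynomial.hermite n)) (Polynomial.aeval ((Real.sqrt 2 : ℝ) * z)
        (Polynomial.derivative (Polynomial.hermite n)) * (Real.sqrt 2 : ℝ)) z := by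
    have h1 := (Polynomial.hermite n).hasDerivAt_aeval ((Real.sqrt 2 : ℝ) * z)
    have h2 : HasDerivAt (fun z : ℂ => (Real.sqrt 2 : ℝ) * z) (Real.sqrt 2 : ℝ) z := by
      simpa using (hasDerivAt_id z).const_mul ((Real.sqrt 2 : ℝ) : ℂ)
    exact h1.comp z h2
  have he : HasDerivAt (fun z : ℂ => exp (-z ^ 2 / 2)) (exp (-z ^ 2 / 2) * -z) z := by
    refine HasDerivAt.cexp ?_
    have := ((hasDerivAt_id z).pow 2).neg.div_const 2
    refine this.congr_deriv ?_
    simp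
    ring
  refine ((hp.const_mul (I ^ n * (hermiteConst n : ℝ))).mul he).congr_deriv ?_
  rw [e0]
  cases n with
  | zero => simp [hermiteFun_def]; ring
  | succ n =>
    have e1 := ladderConst_eq (n + 1)
    have hc' := natCast_mul_hermiteConst n
    have hl : 2 * ladderConst (n + 1)
        = (Real.sqrt 2 : ℝ) * (I * (Real.sqrt (n + 1) : ℝ)) := by
      have h2 := ofReal_sqrt_mul_self (x := 2) (by norm_num)
      push_cast at e1 h2
      rw [← e1]
      linear_combination -ladderConst (n+1) * h2
    rw [← mul_assoc 2, hl, derivative_hermite_succ]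
    simp only [hermiteFun_def, Nat.add_sub_cancel]
    simp only [map_mul, map_add, map_one, map_natCast]
    rw [pow_succ I n]
    linear_combination (exp (-z ^ 2 / 2)) * I ^ n * I * (Real.sqrt 2 : ℝ) *
      Polynomial.aeval (((Real.sqrt 2 : ℝ) : ℂ) * z) (Polynomial.hermite n) * hc'

lemma mul_rotHermiteFun (θ : ℝ) (n : ℕ) (x : ℝ) :
    exp (I * θ / 2) * x * rotHermiteFun θ n x =
      ladderConst n * rotHermiteFun θ (n - 1) x
        - ladderConst (n + 1) * rotHermiteFun θ (n + 1) x := by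
  have := mul_hermiteFun n (exp (I * θ / 2) * x)
  simp only [rotHermiteFun]
  linear_combination exp (I * θ / 4) * this

lemma hasDerivAt_rotHermiteFun (θ : ℝ) (n : ℕ) (x : ℝ) :
    HasDerivAt (rotHermiteFun θ n)
      (exp (I * θ / 2) * (ladderConst n * rotHermiteFun θ (n - 1) x
        + ladderConst (n + 1) * rotHermiteFun θ (n + 1) x)) x := by
  have h1 := hasDerivAt_hermiteFun n (exp (I * θ / 2) * x)
  have h2 : HasDerivAt (fun x : ℝ => exp (I * θ / 2) * (x : ℂ)) (exp (I * θ / 2)) x := by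
    simpa using (ofRealCLM.hasDerivAt (x := x)).const_mul (exp (I * θ / 2))
  refine ((h1.comp x h2).const_mul (exp (I * θ / 4))).congr_deriv ?_
  simp only [rotHermiteFun]
  ring

lemma contDiff_rotHermiteFun (θ : ℝ) (n : ℕ) : ContDiff ℝ ∞ (rotHermiteFun θ n) := by
  have h1 : ContDiff ℝ ∞ (fun x : ℝ => (x : ℂ)) := ofRealCLM.contDiff
  have h2 : ContDiff ℝ ∞ (fun z : ℂ => Polynomial.aeval z (Polynomial.hermite n)) :=
    (Polynomial.contDiff_aeval (𝕜 := ℂ) (Polynomial.hermite n) ∞).restrict_scalars ℝ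
  unfold rotHermiteFun hermiteFun
  have h3 : ContDiff ℝ ∞ (fun x : ℝ => exp (I * θ / 2) * (x : ℂ)) := contDiff_const.mul h1
  exact contDiff_const.mul ((contDiff_const.mul (h2.comp (contDiff_const.mul h3))).mul
    ((h3.pow 2).neg.div_const 2).cexp)

lemma deriv_rotHermiteFun (θ : ℝ) (n : ℕ) : deriv (rotHermiteFun θ n) =
    fun x => exp (I * θ / 2) * (ladderConst n * rotHermiteFun θ (n - 1) x
        + ladderConst (n + 1) * rotHermiteFun θ (n + 1) x) :=
  funext fun x => (hasDerivAt_rotHermiteFun θ n x).deriv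

lemma memLp_deriv_rotHermiteFun {θ : ℝ} (hθ : |θ| < Real.pi / 2) (n : ℕ) :
    MemLp (deriv (rotHermiteFun θ n)) 2 volume := by
  rw [deriv_rotHermiteFun]
  exact (((memLp_rotHermiteFun hθ (n - 1)).const_mul _).add
    ((memLp_rotHermiteFun hθ (n + 1)).const_mul _)).const_mul _

end HermiteFunctions

/-! ### Weak derivatives and integration by parts -/

section WeakDerivatives

open Filter Topology

lemma MeasureTheory.MemLp.integrable_smul_L2R {φ : ℝ → ℝ} (hφ : MemLp φ 2 volume) (u : L2R) :
    Integrable (fun x => φ x • u x) :=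
  memLp_one_iff_integrable.1 (MemLp.smul (p := 2) (q := 2) (r := 1) (Lp.memLp u) hφ)

lemma MeasureTheory.MemLp.integrable_mul_L2R {w : ℝ → ℂ} (hw : MemLp w 2 volume) (u : L2R) :
    Integrable (fun x => w x * u x) :=
  memLp_one_iff_integrable.1 (MemLp.smul (p := 2) (q := 2) (r := 1) (Lp.memLp u) hw)

/-- Smooth cutoff functions `η (x / (k + 1))` exhausting the line. -/
lemma exists_cutoff : ∃ (η : ℕ → ℝ → ℝ) (C : ℝ), (∀ k, ContDiff ℝ ∞ (η k)) ∧
    (∀ k, HasCompactSupport (η k)) ∧ (∀ k x, |η k x| ≤ 1) ∧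
    (∀ k x, |deriv (η k) x| ≤ C / (k + 1)) ∧ ∀ x, Tendsto (fun k => η k x) atTop (𝓝 1) := by
  let b : ContDiffBump (0 : ℝ) := ⟨1, 2, by norm_num, by norm_num⟩
  have hb : ContDiff ℝ ∞ b := b.contDiff
  obtain ⟨C, hC⟩ := (hb.continuous_deriv (by simp)).bounded_above_of_compact_support
    b.hasCompactSupport.deriv
  have hpos : ∀ k : ℕ, (0 : ℝ) < ((k : ℝ) + 1)⁻¹ := fun k => by positivity
  refine ⟨fun k x => b (((k : ℝ) + 1)⁻¹ * x), C, fun k => hb.comp (contDiff_const.mul contDiff_id),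
    fun k => ?_, fun k x => ?_, fun k x => ?_, fun x => ?_⟩
  · exact b.hasCompactSupport.comp_homeomorph (Homeomorph.mulLeft₀ _ (hpos k).ne')
  · rw [abs_of_nonneg b.nonneg]; exact b.le_one
  · rw [deriv_comp_mul_left, smul_eq_mul, abs_mul, abs_of_pos (hpos k), div_eq_inv_mul]
    exact mul_le_mul_of_nonneg_left (hC _) (hpos k).le
  · refine tendsto_const_nhds.congr' ?_
    filter_upwards [eventually_ge_atTop ⌈|x|⌉₊] with k hk
    refine (b.one_of_mem_closedBall ?_).symm
    have hk' : |x| ≤ k := Nat.ceil_le.1 hk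
    have : |((k : ℝ) + 1)⁻¹ * x| ≤ 1 := by
      rw [abs_mul, abs_of_pos (hpos k), inv_mul_le_iff₀ (by positivity)]
      linarith
    simpa [Metric.mem_closedBall, Real.dist_eq] using this

/-- Cutting off makes φ·ηₖ an admissible test function. The extra term φ·ηₖ' tends to zero and is
dominated by C|φ|, so dominated convergence removes the cutoff. This admits Hermite functions as
test functions. -/
lemma IsWeakDeriv.integral_deriv_smul {u g : L2R} (h : IsWeakDeriv u g) {φ : ℝ → ℝ}
    (hφ : ContDiff ℝ ∞ φ) (h2 : MemLp φ 2 volume) (h2' : MemLp (deriv φ) 2 volume) :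
    ∫ x, deriv φ x • u x = - ∫ x, φ x • g x := by
  obtain ⟨η, C, hη, hc, h1, hd, hlim⟩ := exists_cutoff
  have hdiff : Differentiable ℝ φ := hφ.differentiable (by simp)
  have hηd : ∀ k, Differentiable ℝ (η k) := fun k => (hη k).differentiable (by simp)
  have hderiv : ∀ k x, deriv (fun x => φ x * η k x) x
      = deriv φ x * η k x + φ x * deriv (η k) x := fun k x =>
    deriv_fun_mul (hdiff x) (hηd k x)
  have key : ∀ k, ∫ x, (deriv φ x * η k x + φ x * deriv (η k) x) • u x
      = - ∫ x, (φ x * η k x) • g x := fun k => by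
    have := h (fun x => φ x * η k x) (hφ.mul (hη k)) (hc k).mul_left
    simpa only [hderiv] using this
  have hC : 0 ≤ C := by
    have := (abs_nonneg _).trans (hd 0 0)
    simpa using this
  have l1 : Tendsto (fun k => ∫ x, (deriv φ x * η k x + φ x * deriv (η k) x) • u x) atTop
      (𝓝 (∫ x, deriv φ x • u x)) := by
    refine tendsto_integral_of_dominated_convergence
      (fun x => ‖deriv φ x • u x‖ + C * ‖φ x • u x‖) (fun k => ?_) ?_ (fun k => ?_) ?_
    · have hcont : Continuous (fun x => deriv φ x * η k x + φ x * deriv (η k) x) :=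
        ((hφ.continuous_deriv (by simp)).mul (hη k).continuous).add
          (hφ.continuous.mul ((hη k).continuous_deriv (by simp)))
      exact hcont.aestronglyMeasurable.smul (Lp.aestronglyMeasurable u)
    · exact (h2'.integrable_smul_L2R u).norm.add ((h2.integrable_smul_L2R u).norm.const_mul C)
    · refine Eventually.of_forall fun x => ?_
      rw [add_smul]
      refine (norm_add_le _ _).trans (add_le_add ?_ ?_)
      · rw [norm_smul, norm_smul, norm_mul]
        exact mul_le_mul_of_nonneg_right (mul_le_of_le_one_right (norm_nonneg _) (h1 k x))
          (norm_nonneg _)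
      · rw [norm_smul, norm_smul, norm_mul, mul_comm ‖φ x‖, mul_assoc]
        refine mul_le_mul_of_nonneg_right ((hd k x).trans ?_) (by positivity)
        exact div_le_self hC (by linarith [(Nat.cast_nonneg k : (0:ℝ) ≤ k)])
    · refine Eventually.of_forall fun x => ?_
      have t1 : Tendsto (fun k => deriv (η k) x) atTop (𝓝 0) := by
        refine squeeze_zero_norm (fun k => hd k x) ?_
        have := (tendsto_one_div_add_atTop_nhds_zero_nat (𝕜 := ℝ)).const_mul C
        simpa [div_eq_mul_inv] using this
      have := (((hlim x).const_mul (deriv φ x)).add (t1.const_mul (φ x))).smul_const (u x)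
      simpa using this
  have l2 : Tendsto (fun k => - ∫ x, (φ x * η k x) • g x) atTop (𝓝 (- ∫ x, φ x • g x)) := by
    refine (tendsto_integral_of_dominated_convergence
      (fun x => ‖φ x • g x‖) (fun k => ?_) ?_ (fun k => ?_) ?_).neg
    · exact AEStronglyMeasurable.smul (hφ.continuous.mul (hη k).continuous).aestronglyMeasurable
        (Lp.aestronglyMeasurable g)
    · exact (h2.integrable_smul_L2R g).norm
    · refine Eventually.of_forall fun x => ?_
      rw [norm_smul, norm_smul, norm_mul]
      exact mul_le_mul_of_nonneg_right (mul_le_of_le_one_right (norm_nonneg _) (h1 k x))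
          (norm_nonneg _)
    · refine Eventually.of_forall fun x => ?_
      have := ((hlim x).const_mul (φ x)).smul_const (g x)
      simpa using this
  exact tendsto_nhds_unique l1 (l2.congr fun k => (key k).symm)

/-- The test functions so far are real; a complex one is split into real and imaginary parts. -/
lemma IsWeakDeriv.integral_deriv_mul {u g : L2R} (h : IsWeakDeriv u g) {w : ℝ → ℂ}
    (hw : ContDiff ℝ ∞ w) (h2 : MemLp w 2 volume) (h2' : MemLp (deriv w) 2 volume) :
    ∫ x, deriv w x * u x = - ∫ x, w x * g x := by
  have hdiff : Differentiable ℝ w := hw.differentiable (by simp)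
  have dre : deriv (fun x => (w x).re) = fun x => (deriv w x).re := funext fun x =>
    (reCLM.hasFDerivAt.comp_hasDerivAt x (hdiff x).hasDerivAt).deriv
  have dim : deriv (fun x => (w x).im) = fun x => (deriv w x).im := funext fun x =>
    (imCLM.hasFDerivAt.comp_hasDerivAt x (hdiff x).hasDerivAt).deriv
  have h1 := h.integral_deriv_smul (reCLM.contDiff.comp hw) h2.re (by
    show MemLp (deriv fun x => (w x).re) 2 volume
    rw [dre]; exact h2'.re)
  have h3 := h.integral_deriv_smul (imCLM.contDiff.comp hw) h2.im (by
    show MemLp (deriv fun x => (w x).im) 2 volume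
    rw [dim]; exact h2'.im)
  change ∫ x, deriv (fun x => (w x).re) x • u x = - ∫ x, (w x).re • g x at h1
  change ∫ x, deriv (fun x => (w x).im) x • u x = - ∫ x, (w x).im • g x at h3
  rw [dre] at h1
  rw [dim] at h3
  have split : ∀ (v : ℝ → ℂ) (f : L2R), MemLp v 2 volume →
      ∫ x, v x * f x = (∫ x, (v x).re • f x) + I * ∫ x, (v x).im • f x := by
    intro v f hv
    have i1 := MemLp.integrable_smul_L2R (φ := fun x => (v x).re) hv.re f
    have i2 := MemLp.integrable_smul_L2R (φ := fun x => (v x).im) hv.im f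
    rw [← integral_const_mul, ← integral_add i1 (i2.const_mul I)]
    refine integral_congr_ae (Eventually.of_forall fun x => ?_)
    simp only [real_smul]
    conv_lhs => rw [← re_add_im (v x)]
    ring
  rw [split _ _ h2', split _ _ h2, h1, h3]
  ring

lemma isWeakDeriv_toLp {w w' : ℝ → ℂ} (hw : MemLp w 2 volume) (hw' : MemLp w' 2 volume)
    (hd : ∀ x, HasDerivAt w (w' x) x) : IsWeakDeriv (hw.toLp w) (hw'.toLp w') := by
  intro φ hφ hc
  have hdiff : Differentiable ℝ φ := hφ.differentiable (by simp)
  have hcd : Continuous (deriv φ) := hφ.continuous_deriv (by simp)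
  have loc : ∀ {v : ℝ → ℂ}, MemLp v 2 volume → LocallyIntegrable v volume := fun hv =>
    hv.locallyIntegrable (by norm_num)
  have e1 : ∫ x, deriv φ x • hw.toLp w x = ∫ x, deriv φ x • w x := by
    refine integral_congr_ae ?_
    filter_upwards [hw.coeFn_toLp] with x hx
    rw [hx]
  have e2 : ∫ x, φ x • hw'.toLp w' x = ∫ x, φ x • w' x := by
    refine integral_congr_ae ?_
    filter_upwards [hw'.coeFn_toLp] with x hx
    rw [hx]
  rw [e1, e2]
  have := integral_bilinear_hasDerivAt_right_eq_neg_left_of_integrable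
    (L := ContinuousLinearMap.lsmul ℝ ℝ (E := ℂ)) (u := φ) (v := w) (u' := deriv φ) (v' := w')
    (fun x _ => (hdiff x).hasDerivAt) (fun x _ => hd x)
    ((loc hw').integrable_smul_left_of_hasCompactSupport hφ.continuous hc)
    ((loc hw).integrable_smul_left_of_hasCompactSupport hcd hc.deriv)
    ((loc hw).integrable_smul_left_of_hasCompactSupport hφ.continuous hc)
  simp only [ContinuousLinearMap.lsmul_apply] at this
  rw [this, neg_neg]

end WeakDerivatives

/-! ### The rotated Hermite functions in the form domain -/

section RotatedHermite

variable {θ : ℝ}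

lemma isWeakDeriv_rotHermite (hθ : |θ| < Real.pi / 2) (n : ℕ) :
    IsWeakDeriv (rotHermite hθ n) (exp (I * θ / 2) • (ladderConst n • rotHermite hθ (n - 1)
      + ladderConst (n + 1) • rotHermite hθ (n + 1))) :=
  isWeakDeriv_toLp (memLp_rotHermiteFun hθ n)
    ((((memLp_rotHermiteFun hθ (n - 1)).const_mul (ladderConst n)).add
      ((memLp_rotHermiteFun hθ (n + 1)).const_mul (ladderConst (n + 1)))).const_mul
        (exp (I * θ / 2))) (hasDerivAt_rotHermiteFun θ n)

lemma isMulX_rotHermite (hθ : |θ| < Real.pi / 2) (n : ℕ) :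
    IsMulX (rotHermite hθ n) (exp (-(I * θ / 2)) • (ladderConst n • rotHermite hθ (n - 1)
      - ladderConst (n + 1) • rotHermite hθ (n + 1))) := by
  have h : MemLp (fun x : ℝ => exp (-(I * θ / 2)) * (ladderConst n * rotHermiteFun θ (n - 1) x
      - ladderConst (n + 1) * rotHermiteFun θ (n + 1) x)) 2 volume :=
    (((memLp_rotHermiteFun hθ (n - 1)).const_mul (ladderConst n)).sub
      ((memLp_rotHermiteFun hθ (n + 1)).const_mul (ladderConst (n + 1)))).const_mul _
  change ∀ᵐ x : ℝ, (h.toLp _ : ℝ → ℂ) x = _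
  filter_upwards [h.coeFn_toLp, (memLp_rotHermiteFun hθ n).coeFn_toLp] with x h1 h2
  rw [rotHermite, h1, h2, ← mul_rotHermiteFun, ← mul_assoc, ← mul_assoc, ← exp_add,
    neg_add_cancel, exp_zero, one_mul]

lemma rotHermite_mem (hθ : |θ| < Real.pi / 2) (n : ℕ) : rotHermite hθ n ∈ formDomain :=
  ⟨⟨_, isWeakDeriv_rotHermite hθ n⟩, _, isMulX_rotHermite hθ n⟩

/-- The operator `-i (e^{-iθ/2} ∂ₓ + e^{iθ/2} x)`. -/
noncomputable def lowerOp (θ : ℝ) : formDomain →ₗ[ℂ] L2R :=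
  (-I * exp (-(I * θ / 2))) • weakDeriv - (I * exp (I * θ / 2)) • mulX

/-- The operator `-i (e^{-iθ/2} ∂ₓ - e^{iθ/2} x)`. -/
noncomputable def raiseOp (θ : ℝ) : formDomain →ₗ[ℂ] L2R :=
  (-I * exp (-(I * θ / 2))) • weakDeriv + (I * exp (I * θ / 2)) • mulX

lemma two_mul_ladderConst (n : ℕ) : 2 * ladderConst n = I * (Real.sqrt (2 * n) : ℝ) := by
  have : Real.sqrt (2 * n) = 2 * Real.sqrt (n / 2) := by
    rw [show (2 * n : ℝ) = 2 ^ 2 * (n / 2) by ring, Real.sqrt_mul (by positivity),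
      Real.sqrt_sq (by norm_num)]
  rw [ladderConst, this]
  push_cast
  ring

lemma exp_neg_mul_exp (z : ℂ) : exp (-z) * exp z = 1 := by rw [← exp_add]; simp

lemma exp_mul_exp_neg (z : ℂ) : exp z * exp (-z) = 1 := by rw [← exp_add]; simp

lemma weakDeriv_rotHermite (hθ : |θ| < Real.pi / 2) (n : ℕ) :
    weakDeriv ⟨_, rotHermite_mem hθ n⟩ = exp (I * θ / 2) •
      (ladderConst n • rotHermite hθ (n - 1) + ladderConst (n + 1) • rotHermite hθ (n + 1)) :=
  (weakDeriv_spec _).unique (isWeakDeriv_rotHermite hθ n)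

lemma mulX_rotHermite (hθ : |θ| < Real.pi / 2) (n : ℕ) :
    mulX ⟨_, rotHermite_mem hθ n⟩ = exp (-(I * θ / 2)) •
      (ladderConst n • rotHermite hθ (n - 1) - ladderConst (n + 1) • rotHermite hθ (n + 1)) :=
  (mulX_spec _).unique (isMulX_rotHermite hθ n)

/-- The phases of the operator cancel those produced by differentiating and by multiplying with x,
so the two φₙ₊₁ terms cancel and the φₙ₋₁ terms double. The result does not depend on θ. -/
lemma lowerOp_rotHermite (hθ : |θ| < Real.pi / 2) (n : ℕ) :
    lowerOp θ ⟨_, rotHermite_mem hθ n⟩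
      = ((Real.sqrt (2 * n) : ℝ) : ℂ) • rotHermite hθ (n - 1) := by
  have h := two_mul_ladderConst n
  have h1 := exp_neg_mul_exp (I * θ / 2)
  simp only [lowerOp, LinearMap.sub_apply, LinearMap.smul_apply, weakDeriv_rotHermite,
    mulX_rotHermite]
  match_scalars
  · linear_combination (-2 * I * ladderConst n) * h1 - I * h
      - ((Real.sqrt (2 * n) : ℝ) : ℂ) * I_sq
  · ring

lemma raiseOp_rotHermite (hθ : |θ| < Real.pi / 2) (n : ℕ) :
    raiseOp θ ⟨_, rotHermite_mem hθ n⟩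
      = ((Real.sqrt (2 * (n + 1 : ℕ)) : ℝ) : ℂ) • rotHermite hθ (n + 1) := by
  have h := two_mul_ladderConst (n + 1)
  have h1 := exp_neg_mul_exp (I * θ / 2)
  simp only [raiseOp, LinearMap.add_apply, LinearMap.smul_apply, weakDeriv_rotHermite,
    mulX_rotHermite]
  match_scalars
  · ring
  · push_cast at h ⊢
    linear_combination (-2 * I * ladderConst (n + 1)) * h1 - I * h
      - ((Real.sqrt (2 * (n + 1)) : ℝ) : ℂ) * I_sq

lemma inner_rotHermite (hθ : |θ| < Real.pi / 2) (n : ℕ) (u : L2R) :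
    ⟪rotHermite hθ n, u⟫_ℂ = ∫ x, (starRingEnd ℂ) (rotHermiteFun θ n x) * u x := by
  rw [L2.inner_def]
  refine integral_congr_ae ?_
  filter_upwards [(memLp_rotHermiteFun hθ n).coeFn_toLp] with x h1
  rw [rotHermite, h1, RCLike.inner_apply, mul_comm]

lemma memLp_conj {w : ℝ → ℂ} (hw : MemLp w 2 volume) :
    MemLp (fun x => (starRingEnd ℂ) (w x)) 2 volume := hw.star

lemma hasDerivAt_conj {w : ℝ → ℂ} {w' : ℂ} {x : ℝ} (hw : HasDerivAt w w' x) :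
    HasDerivAt (fun x => (starRingEnd ℂ) (w x)) ((starRingEnd ℂ) w') x := hw.star

/-- Only the left factor has to be smooth: its conjugate serves as the test function for the weak
derivative of `u`. -/
lemma inner_rotHermite_weakDeriv (hθ : |θ| < Real.pi / 2) (n : ℕ) (u : formDomain) :
    ⟪rotHermite hθ n, weakDeriv u⟫_ℂ
      = -⟪weakDeriv ⟨_, rotHermite_mem hθ n⟩, (u : L2R)⟫_ℂ := by
  have hd : deriv (fun x => (starRingEnd ℂ) (rotHermiteFun θ n x)) =
      fun x => (starRingEnd ℂ) (deriv (rotHermiteFun θ n) x) := funext fun x => by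
    rw [deriv_rotHermiteFun]
    exact (hasDerivAt_conj (hasDerivAt_rotHermiteFun θ n x)).deriv
  have hs : ContDiff ℝ ∞ (fun x => (starRingEnd ℂ) (rotHermiteFun θ n x)) :=
    conjCLE.contDiff.comp (contDiff_rotHermiteFun θ n)
  have key := (weakDeriv_spec u).integral_deriv_mul hs (memLp_conj (memLp_rotHermiteFun hθ n))
    (by rw [hd]; exact memLp_conj (memLp_deriv_rotHermiteFun hθ n))
  rw [inner_rotHermite, ← neg_eq_iff_eq_neg, ← key, hd, weakDeriv_rotHermite, inner_smul_left,
    inner_add_left, inner_smul_left, inner_smul_left, inner_rotHermite, inner_rotHermite]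
  have i1 := (memLp_conj (memLp_rotHermiteFun hθ (n - 1))).integrable_mul_L2R u
  have i2 := (memLp_conj (memLp_rotHermiteFun hθ (n + 1))).integrable_mul_L2R u
  rw [← integral_const_mul, ← integral_const_mul, ← integral_add (i1.const_mul _) (i2.const_mul _),
    ← integral_const_mul]
  refine integral_congr_ae (Filter.Eventually.of_forall fun x => ?_)
  simp only [deriv_rotHermiteFun, map_mul, map_add]
  ring

lemma inner_rotHermite_mulX (hθ : |θ| < Real.pi / 2) (n : ℕ) (u : formDomain) :
    ⟪rotHermite hθ n, mulX u⟫_ℂ = ⟪mulX ⟨_, rotHermite_mem hθ n⟩, (u : L2R)⟫_ℂ := by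
  rw [L2.inner_def, L2.inner_def]
  refine integral_congr_ae ?_
  filter_upwards [mulX_spec u, mulX_spec ⟨_, rotHermite_mem hθ n⟩] with x h1 h2
  rw [h1, h2, RCLike.inner_apply, RCLike.inner_apply, map_mul, conj_ofReal]
  ring

lemma conj_exp_half (θ : ℝ) : (starRingEnd ℂ) (exp (I * (θ : ℝ) / 2)) = exp (-(I * θ / 2)) := by
  rw [← exp_conj]
  congr 1
  simp [map_div₀, neg_div, conj_ofNat]

lemma conj_exp_neg_half (θ : ℝ) :
    (starRingEnd ℂ) (exp (-(I * (θ : ℝ) / 2))) = exp (I * θ / 2) := by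
  rw [← conj_exp_half, conj_conj]

/-- Conjugation sends e^{-iθ/2} to e^{iθ/2}, so the formal adjoint of lowering is raising at the
opposite angle. That angle is a variable with an equation, which lets θ = θ' = 0 be used directly
for the Hermite basis. -/
lemma inner_rotHermite_lowerOp {θ' : ℝ} (hθ' : |θ'| < Real.pi / 2) (h : θ' = -θ) (n : ℕ)
    (u : formDomain) :
    ⟪rotHermite hθ' n, lowerOp θ u⟫_ℂ
      = (Real.sqrt (2 * (n + 1 : ℕ)) : ℝ) * ⟪rotHermite hθ' (n + 1), (u : L2R)⟫_ℂ := by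
  have e : ⟪rotHermite hθ' n, lowerOp θ u⟫_ℂ
      = ⟪raiseOp θ' ⟨_, rotHermite_mem hθ' n⟩, (u : L2R)⟫_ℂ := by
    have c1 : I * (θ' : ℂ) / 2 = -(I * θ / 2) := by rw [h]; push_cast; ring
    simp only [lowerOp, raiseOp, LinearMap.sub_apply, LinearMap.add_apply, LinearMap.smul_apply,
      inner_sub_right, inner_add_left, inner_smul_right, inner_smul_left,
      inner_rotHermite_weakDeriv, inner_rotHermite_mulX, map_mul, map_neg, conj_I, c1, neg_neg,
      conj_exp_half, conj_exp_neg_half]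
    ring
  rw [e, raiseOp_rotHermite, inner_smul_left, conj_ofReal]

lemma inner_rotHermite_raiseOp {θ' : ℝ} (hθ' : |θ'| < Real.pi / 2) (h : θ' = -θ) (n : ℕ)
    (u : formDomain) :
    ⟪rotHermite hθ' n, raiseOp θ u⟫_ℂ
      = (Real.sqrt (2 * n) : ℝ) * ⟪rotHermite hθ' (n - 1), (u : L2R)⟫_ℂ := by
  have e : ⟪rotHermite hθ' n, raiseOp θ u⟫_ℂ
      = ⟪lowerOp θ' ⟨_, rotHermite_mem hθ' n⟩, (u : L2R)⟫_ℂ := by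
    have c1 : I * (θ' : ℂ) / 2 = -(I * θ / 2) := by rw [h]; push_cast; ring
    simp only [lowerOp, raiseOp, LinearMap.sub_apply, LinearMap.add_apply, LinearMap.smul_apply,
      inner_sub_left, inner_add_right, inner_smul_right, inner_smul_left,
      inner_rotHermite_weakDeriv, inner_rotHermite_mulX, map_mul, map_neg, conj_I, c1, neg_neg,
      conj_exp_half, conj_exp_neg_half]
    ring
  rw [e, lowerOp_rotHermite, inner_smul_left, conj_ofReal]

/-- Since the left function carries the angle -θ, conjugation turns the integrand into the square of
the right one, a complex Gaussian. -/
lemma inner_rotHermite_zero_zero (hθ : |θ| < Real.pi / 2) {θ' : ℝ} (hθ' : |θ'| < Real.pi / 2)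
    (h : θ' = -θ) : ⟪rotHermite hθ' 0, rotHermite hθ 0⟫_ℂ = 1 := by
  have hpi := Real.pi_pos
  have hre : 0 < (exp (I * θ)).re := by
    rw [mul_comm, exp_mul_I, ← ofReal_cos, ← ofReal_sin]
    simpa [-ofReal_cos, -ofReal_sin] using Real.cos_pos_of_mem_Ioo (abs_lt.mp hθ)
  have hc : hermiteConst 0 * hermiteConst 0 = (Real.sqrt Real.pi)⁻¹ := by
    simp only [hermiteConst, Nat.factorial_zero, Nat.cast_one, one_mul]
    rw [← mul_inv, Real.mul_self_sqrt (by positivity)]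
  have e1 : ⟪rotHermite hθ' 0, rotHermite hθ 0⟫_ℂ
      = ∫ x : ℝ, (exp (I * θ / 2) * ((Real.sqrt Real.pi)⁻¹ : ℝ)) * exp (-exp (I * θ) * x ^ 2) := by
    rw [inner_rotHermite]
    refine integral_congr_ae ?_
    filter_upwards [(memLp_rotHermiteFun hθ 0).coeFn_toLp] with x h1
    have c1 : I * (θ' : ℂ) = -(I * θ) := by rw [h]; push_cast; ring
    have c2 : (starRingEnd ℂ) (I * (θ : ℂ)) = - (I * θ) := by simp
    rw [rotHermite, h1]
    simp only [rotHermiteFun, hermiteFun_zero, map_mul, conj_ofReal, ← exp_conj, c1, map_div₀,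
      map_neg, map_pow, c2, neg_neg, map_ofNat]
    rw [← hc, ofReal_mul]
    have s1 : exp (I * θ / 4) * exp (I * θ / 4) = exp (I * θ / 2) := by
      rw [← exp_add]; ring_nf
    have s2 : (exp (I * θ / 2)) ^ 2 = exp (I * θ) := by
      rw [← exp_nat_mul]; congr 1; push_cast; ring
    have s3 : -(exp (I * θ / 2) * (x : ℂ)) ^ 2 / 2 + -(exp (I * θ / 2) * (x : ℂ)) ^ 2 / 2
        = -exp (I * θ) * x ^ 2 := by rw [mul_pow, s2]; ring
    rw [← s3, exp_add, ← s1]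
    ring
  -- The argument -θ lies in the principal strip, so the principal root is √π e^{-iθ/2}; the factors
  -- e^{iθ/4} of the two functions cancel its phase.
  have hsq : ((Real.pi : ℂ) / exp (I * θ)) ^ (1 / 2 : ℂ)
      = (Real.sqrt Real.pi : ℝ) * exp (-(I * θ / 2)) := by
    have hθ' := abs_lt.1 hθ
    have hdiv : (Real.pi : ℂ) / exp (I * θ) = exp (Real.log Real.pi + -(I * θ)) := by
      rw [exp_add, exp_neg, ← ofReal_exp, Real.exp_log hpi, div_eq_mul_inv]
    have him : ((Real.log Real.pi : ℂ) + -(I * θ)).im = -θ := by simp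
    rw [hdiv, cpow_def_of_ne_zero (exp_ne_zero _), log_exp (by rw [him]; linarith)
      (by rw [him]; linarith), Real.sqrt_eq_rpow, Real.rpow_def_of_pos hpi, ofReal_exp, ← exp_add]
    congr 1
    push_cast
    ring
  rw [e1, integral_const_mul, integral_gaussian_complex hre, hsq]
  have s1 := exp_mul_exp_neg (I * θ / 2)
  have s2 : (((Real.sqrt Real.pi)⁻¹ : ℝ) : ℂ) * (Real.sqrt Real.pi : ℝ) = 1 := by
    rw [← ofReal_mul, inv_mul_cancel₀ (by positivity), ofReal_one]
  linear_combination (((Real.sqrt Real.pi)⁻¹ : ℝ) : ℂ) * (Real.sqrt Real.pi : ℝ) * s1 + s2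

/-- The rotated Hermite functions for opposite angles are biorthonormal. -/
lemma inner_rotHermite_rotHermite (hθ : |θ| < Real.pi / 2) {θ' : ℝ} (hθ' : |θ'| < Real.pi / 2)
    (h : θ' = -θ) (n k : ℕ) :
    ⟪rotHermite hθ' n, rotHermite hθ k⟫_ℂ = if n = k then 1 else 0 := by
  -- Evaluating lowering on either side of the scalar product relates the pairs (n, k - 1) and (n +
  -- 1, k), which drives the induction on n.
  have low : ∀ n k : ℕ, ((Real.sqrt (2 * k) : ℝ) : ℂ) * ⟪rotHermite hθ' n, rotHermite hθ (k - 1)⟫_ℂ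
      = (Real.sqrt (2 * (n + 1 : ℕ)) : ℝ) * ⟪rotHermite hθ' (n + 1), rotHermite hθ k⟫_ℂ := by
    intro n k
    have := inner_rotHermite_lowerOp (θ := θ) hθ' h n ⟨_, rotHermite_mem hθ k⟩
    rwa [lowerOp_rotHermite, inner_smul_right] at this
  have ne : ∀ n : ℕ, ((Real.sqrt (2 * (n + 1 : ℕ)) : ℝ) : ℂ) ≠ 0 := fun n => by
    rw [ofReal_ne_zero]; positivity
  -- Raising, moved to the left, becomes lowering of φ₀, whose coefficient is √0.
  have h0 : ∀ k, ⟪rotHermite hθ' 0, rotHermite hθ (k + 1)⟫_ℂ = 0 := by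
    intro k
    have := inner_rotHermite_raiseOp (θ := θ) hθ' h 0 ⟨_, rotHermite_mem hθ k⟩
    rw [raiseOp_rotHermite, inner_smul_right] at this
    simpa only [Nat.cast_zero, mul_zero, Real.sqrt_zero, ofReal_zero, zero_mul, mul_eq_zero,
      ne k, false_or] using this
  induction n generalizing k with
  | zero =>
    cases k with
    | zero => simpa using inner_rotHermite_zero_zero hθ hθ' h
    | succ k => simpa using h0 k
  | succ n ih =>
    have := low n k
    cases k with
    | zero =>
      simpa only [Nat.cast_zero, mul_zero, Real.sqrt_zero, ofReal_zero, zero_mul, zero_eq_mul,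
        ne n, false_or, Nat.succ_ne_zero, if_false] using this
    | succ k =>
      rw [Nat.add_sub_cancel, ih k] at this
      by_cases hnk : n = k
      · subst hnk
        simp only [if_true] at this ⊢
        exact (mul_left_cancel₀ (ne n) this).symm
      · have : ⟪rotHermite hθ' (n + 1), rotHermite hθ (k + 1)⟫_ℂ = 0 := by
          simpa only [hnk, if_false, mul_zero, zero_eq_mul, ne n, false_or] using this
        simpa [hnk] using this

end RotatedHermite

/-! ### Completeness of the rotated Hermite functions -/

section Completeness

open Filter Topology
open scoped FourierTransform SchwartzMap

/-- An integrable function on the line whose Fourier transform vanishes is zero. -/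
lemma ae_eq_zero_of_fourier_eq_zero {g : ℝ → ℂ} (hg : Integrable g)
    (h : ∀ ξ : ℝ, 𝓕 g ξ = 0) : g =ᵐ[volume] 0 := by
  refine ae_eq_zero_of_integral_contDiff_smul_eq_zero hg.locallyIntegrable fun φ hφ hc => ?_
  have hc' : HasCompactSupport (fun x => (φ x : ℂ)) := hc.comp_left (g := ofReal) ofReal_zero
  let ψ : 𝓢(ℝ, ℂ) := hc'.toSchwartzMap (ofRealCLM.contDiff.comp hφ)
  -- Every test function is the Fourier transform of a Schwartz function, so the multiplication
  -- formula moves the transform onto g, where it vanishes.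
  let χ : 𝓢(ℝ, ℂ) := 𝓕⁻ ψ
  have hψ : ∀ x, 𝓕 (χ : ℝ → ℂ) x = φ x := fun x => by
    have h1 : 𝓕 χ = ψ := FourierTransform.fourier_fourierInv_eq ψ
    rw [← SchwartzMap.fourier_coe, h1]
    rfl
  have key : ∫ ξ, 𝓕 (χ : ℝ → ℂ) ξ • g ξ = ∫ x, χ x • 𝓕 g x := by
    have := VectorFourier.integral_fourierIntegral_smul_eq_flip (μ := volume) (ν := volume)
      (L := innerₗ ℝ) Real.continuous_fourierChar continuous_inner χ.integrable hg
    simp only [flip_innerₗ] at this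
    exact this
  simp only [hψ, h, smul_zero, integral_zero] at key
  simpa using key

/-- A function with exponential moments, all of whose power moments vanish, is zero. -/
lemma ae_eq_zero_of_moments_eq_zero {g : ℝ → ℂ} (hm : AEStronglyMeasurable g volume)
    (hg : ∀ c : ℝ, Integrable (fun x => Real.exp (c * |x|) * ‖g x‖))
    (h : ∀ k : ℕ, ∫ x : ℝ, (x : ℂ) ^ k * g x = 0) : g =ᵐ[volume] 0 := by
  have hg0 : Integrable g := by
    refine (integrable_norm_iff hm).1 ?_
    simpa using hg 0
  refine ae_eq_zero_of_fourier_eq_zero hg0 fun ξ => ?_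
  -- The exponential in the Fourier integral is expanded in powers of x and integrated termwise. The
  -- sum of the absolute values is exp(|2πξ||x|)‖g‖, integrable by assumption.
  have hs := hasSum_integral_of_dominated_convergence
    (F := fun (k : ℕ) (x : ℝ) => ((-(2 * Real.pi * ξ) * I) * x) ^ k / k.factorial * g x)
    (f := fun x : ℝ => exp (-(2 * Real.pi * ξ) * I * x) * g x) (μ := volume)
    (fun (k : ℕ) (x : ℝ) => (|2 * Real.pi * ξ| * |x|) ^ k / k.factorial * ‖g x‖)
    (fun k => ?_) (fun k => ?_) ?_ ?_ ?_
  · have hz : (fun k : ℕ => ∫ x : ℝ, ((-(2 * Real.pi * ξ) * I) * x) ^ k / k.factorial * g x)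
        = fun k => 0 := funext fun k => by
      have : ∀ x : ℝ, ((-(2 * Real.pi * ξ) * I) * x) ^ k / k.factorial * g x
          = ((-(2 * Real.pi * ξ) * I) ^ k / k.factorial) * ((x : ℂ) ^ k * g x) := fun x => by
        rw [mul_pow]; ring
      simp only [this]
      rw [integral_const_mul, h k, mul_zero]
    rw [hz] at hs
    have := hs.unique hasSum_zero
    rw [Real.fourier_eq, ← this]
    refine integral_congr_ae (Eventually.of_forall fun x => ?_)
    simp only [Circle.smul_def, Real.fourierChar_apply, smul_eq_mul]
    congr 2
    simp
    ring
  · refine AEStronglyMeasurable.mul (Continuous.aestronglyMeasurable ?_) hm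
    fun_prop
  · refine Eventually.of_forall fun x => le_of_eq ?_
    simp [abs_mul]
  · refine Eventually.of_forall fun x => ?_
    exact (Real.summable_pow_div_factorial _).mul_right _
  · refine (hg |2 * Real.pi * ξ|).congr (Eventually.of_forall fun x => ?_)
    simp only [tsum_mul_right]
    rw [Real.exp_eq_exp_ℝ, NormedSpace.exp_eq_tsum_div]
  · refine Eventually.of_forall fun x => ?_
    refine HasSum.mul_right _ ?_
    have := NormedSpace.expSeries_div_hasSum_exp (-(2 * Real.pi * ξ) * I * x)
    rwa [← Complex.exp_eq_exp_ℂ] at this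

variable {θ : ℝ}

/-- Stability of the span under multiplication by x puts every xᵏφ₀ into it, so that orthogonality
to the Hermite functions becomes vanishing of moments. -/
lemma exists_mem_span_rotHermite_isMulX (hθ : |θ| < Real.pi / 2) {v : L2R}
    (hv : v ∈ Submodule.span ℂ (Set.range (rotHermite hθ))) :
    ∃ w ∈ Submodule.span ℂ (Set.range (rotHermite hθ)), IsMulX v w := by
  induction hv using Submodule.span_induction with
  | mem x hx =>
    obtain ⟨n, rfl⟩ := hx
    refine ⟨_, ?_, isMulX_rotHermite hθ n⟩
    have hm : ∀ k, rotHermite hθ k ∈ Submodule.span ℂ (Set.range (rotHermite hθ)) :=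
      fun k => Submodule.subset_span ⟨k, rfl⟩
    exact Submodule.smul_mem _ _ (Submodule.sub_mem _ (Submodule.smul_mem _ _ (hm _))
      (Submodule.smul_mem _ _ (hm _)))
  | zero =>
    refine ⟨0, Submodule.zero_mem _, ?_⟩
    filter_upwards [Lp.coeFn_zero ℂ 2 (volume : Measure ℝ)] with x _
    simp
  | add x y _ _ hx hy =>
    obtain ⟨a, ha, ha'⟩ := hx
    obtain ⟨b, hb, hb'⟩ := hy
    exact ⟨a + b, Submodule.add_mem _ ha hb, ha'.add hb'⟩
  | smul c x _ hx =>
    obtain ⟨a, ha, ha'⟩ := hx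
    exact ⟨c • a, Submodule.smul_mem _ c ha, ha'.smul c⟩

lemma exists_mem_span_rotHermite_pow (hθ : |θ| < Real.pi / 2) (k : ℕ) :
    ∃ v ∈ Submodule.span ℂ (Set.range (rotHermite hθ)),
      ∀ᵐ x : ℝ, v x = (x : ℂ) ^ k * rotHermiteFun θ 0 x := by
  induction k with
  | zero =>
    refine ⟨rotHermite hθ 0, Submodule.subset_span ⟨0, rfl⟩, ?_⟩
    filter_upwards [(memLp_rotHermiteFun hθ 0).coeFn_toLp] with x hx
    rw [rotHermite, hx, pow_zero, one_mul]
  | succ k ih =>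
    obtain ⟨v, hv, hv'⟩ := ih
    obtain ⟨w, hw, hw'⟩ := exists_mem_span_rotHermite_isMulX hθ hv
    refine ⟨w, hw, ?_⟩
    filter_upwards [hv', hw'] with x h1 h2
    rw [h2, h1]
    ring

lemma norm_rotHermiteFun_zero (θ x : ℝ) :
    ‖rotHermiteFun θ 0 x‖ = |hermiteConst 0| * Real.exp (-(Real.cos θ / 2) * x ^ 2) := by
  have s2 : (exp (I * θ / 2)) ^ 2 = exp (θ * I) := by
    rw [← exp_nat_mul]; congr 1; push_cast; ring
  rw [rotHermiteFun, hermiteFun_zero, norm_mul, norm_mul, norm_real, norm_exp, norm_exp,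
    mul_pow, s2]
  have e1 : (I * (θ : ℂ) / 4).re = 0 := by simp
  have e2 : (-(exp (θ * I) * (x : ℂ) ^ 2) / 2).re = -(Real.cos θ / 2) * x ^ 2 := by
    rw [← ofReal_pow, exp_mul_I, ← ofReal_cos, ← ofReal_sin]
    simp [-ofReal_cos, -ofReal_sin, -ofReal_pow]
    ring
  rw [e1, e2, Real.exp_zero, one_mul, Real.norm_eq_abs]

/-- φ₀ decays like a Gaussian of rate cos θ / 2 > 0; half of that rate absorbs the exponential and
the other half keeps the function in L². Paired with an L² function this yields the exponential
moments. -/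
lemma memLp_exp_mul_rotHermiteFun_zero (hθ : |θ| < Real.pi / 2) (c : ℝ) :
    MemLp (fun x : ℝ => Real.exp (c * |x|) * ‖rotHermiteFun θ 0 x‖) 2 volume := by
  have hα : 0 < Real.cos θ := Real.cos_pos_of_mem_Ioo (abs_lt.mp hθ)
  have h1 := memLp_pow_mul_gauss (a := ((Real.cos θ / 4 : ℝ) : ℂ)) (by
    rw [ofReal_re]; positivity) 0
  refine (h1.norm.const_mul (Real.exp (c ^ 2 / Real.cos θ) * |hermiteConst 0|)).mono' ?_
    (Eventually.of_forall fun x => ?_)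
  · have := (contDiff_rotHermiteFun θ 0).continuous
    exact Continuous.aestronglyMeasurable (by fun_prop)
  · rw [Real.norm_of_nonneg (by positivity), norm_rotHermiteFun_zero, pow_zero, one_mul, norm_exp]
    have e : (-((Real.cos θ / 4 : ℝ) : ℂ) * (x : ℂ) ^ 2).re = -(Real.cos θ / 4) * x ^ 2 := by
      rw [← ofReal_pow, re_mul_ofReal, neg_re, ofReal_re]
    rw [e]
    have key : Real.exp (c * |x|) * Real.exp (-(Real.cos θ / 2) * x ^ 2) ≤
        Real.exp (c ^ 2 / Real.cos θ) * Real.exp (-(Real.cos θ / 4) * x ^ 2) := by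
      rw [← Real.exp_add, ← Real.exp_add, Real.exp_le_exp]
      have hs : |x| ^ 2 = x ^ 2 := sq_abs x
      -- Completing the square is what fixes the constant c² / cos θ.
      have h3 : c ^ 2 / Real.cos θ + -(Real.cos θ / 4) * x ^ 2
          - (c * |x| + -(Real.cos θ / 2) * x ^ 2)
          = (c / Real.cos θ - |x| / 2) ^ 2 * Real.cos θ := by
        rw [← hs]; field_simp; ring
      nlinarith [mul_nonneg (sq_nonneg (c / Real.cos θ - |x| / 2)) hα.le]
    calc _ = |hermiteConst 0| * (Real.exp (c * |x|) * Real.exp (-(Real.cos θ / 2) * x ^ 2)) := by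
          ring
      _ ≤ |hermiteConst 0| * (Real.exp (c ^ 2 / Real.cos θ) *
            Real.exp (-(Real.cos θ / 4) * x ^ 2)) := by gcongr
      _ = _ := by ring

/-- The rotated Hermite functions are total in `L²(ℝ)`. -/
theorem eq_zero_of_inner_rotHermite_eq_zero (hθ : |θ| < Real.pi / 2) {u : L2R}
    (h : ∀ n, ⟪rotHermite hθ n, u⟫_ℂ = 0) : u = 0 := by
  have hspan : ∀ v ∈ Submodule.span ℂ (Set.range (rotHermite hθ)), ⟪v, u⟫_ℂ = 0 := by
    intro v hv
    induction hv using Submodule.span_induction with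
    | mem x hx => obtain ⟨n, rfl⟩ := hx; exact h n
    | zero => exact inner_zero_left _
    | add x y _ _ hx hy => rw [inner_add_left, hx, hy, add_zero]
    | smul c x _ hx => rw [inner_smul_left, hx, mul_zero]
  have hcont := (contDiff_rotHermiteFun θ 0).continuous
  -- The k-th moment of this product is ⟨xᵏφ₀, u⟩. As φ₀ has no zeros, its vanishing forces u = 0.
  have hzero : (fun x => (starRingEnd ℂ) (rotHermiteFun θ 0 x) * u x) =ᵐ[volume] 0 := by
    refine ae_eq_zero_of_moments_eq_zero ?_ (fun c => ?_) fun k => ?_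
    · exact (continuous_conj.comp hcont).aestronglyMeasurable.mul (Lp.aestronglyMeasurable u)
    · have := (memLp_exp_mul_rotHermiteFun_zero hθ c).integrable_smul_L2R u
      refine this.norm.congr (Eventually.of_forall fun x => ?_)
      beta_reduce
      rw [norm_smul, norm_mul, norm_norm, norm_mul, RCLike.norm_conj,
        Real.norm_of_nonneg (Real.exp_pos _).le, mul_assoc]
    · obtain ⟨v, hv, hv'⟩ := exists_mem_span_rotHermite_pow hθ k
      rw [← hspan v hv, L2.inner_def]
      refine integral_congr_ae ?_
      filter_upwards [hv'] with x hx
      rw [RCLike.inner_apply, hx]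
      simp
      ring
  apply Lp.ext
  filter_upwards [hzero, Lp.coeFn_zero ℂ 2 (volume : Measure ℝ)] with x hx hx0
  rw [hx0]
  have hne : (starRingEnd ℂ) (rotHermiteFun θ 0 x) ≠ 0 := by
    rw [Ne, map_eq_zero, ← norm_eq_zero, norm_rotHermiteFun_zero, hermiteConst]
    have := Real.pi_pos
    positivity
  exact (mul_eq_zero.1 hx).resolve_left hne

end Completeness

/-! ### The Hermite basis, coercivity and compactness -/

section HermiteBasis

open Filter Topology

lemma abs_zero_lt_pi_div_two : |(0 : ℝ)| < Real.pi / 2 := by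
  rw [abs_zero]; exact Real.pi_div_two_pos

/-- The (unrotated) Hermite functions as a Hilbert basis of `L²(ℝ)`. -/
noncomputable def hermiteBasis : HilbertBasis ℕ ℂ L2R :=
  HilbertBasis.mkOfOrthogonalEqBot (v := rotHermite abs_zero_lt_pi_div_two)
    (orthonormal_iff_ite.2 fun i j =>
      inner_rotHermite_rotHermite abs_zero_lt_pi_div_two abs_zero_lt_pi_div_two (by simp) i j)
    (by
      rw [Submodule.eq_bot_iff]
      intro u hu
      refine eq_zero_of_inner_rotHermite_eq_zero abs_zero_lt_pi_div_two fun n => ?_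
      exact (Submodule.mem_orthogonal _ _).1 hu _ (Submodule.subset_span ⟨n, rfl⟩))

lemma hermiteBasis_apply (n : ℕ) : hermiteBasis n = rotHermite abs_zero_lt_pi_div_two n := by
  rw [hermiteBasis, HilbertBasis.coe_mkOfOrthogonalEqBot]

lemma HilbertBasis.hasSum_norm_inner_sq {ι E : Type*} [NormedAddCommGroup E]
    [InnerProductSpace ℂ E] (b : HilbertBasis ι ℂ E) (u : E) :
    HasSum (fun n => ‖⟪b n, u⟫_ℂ‖ ^ 2) (‖u‖ ^ 2) := by
  have h := Complex.hasSum_re (b.hasSum_inner_mul_inner u u)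
  rw [inner_self_eq_norm_sq_to_K] at h
  convert h using 1
  · funext n
    rw [← inner_conj_symm, mul_conj, ofReal_re, normSq_eq_norm_sq, RCLike.norm_conj]
  · norm_cast

lemma inner_hermiteBasis_lowerOp (n : ℕ) (u : formDomain) :
    ⟪hermiteBasis n, lowerOp 0 u⟫_ℂ
      = (Real.sqrt (2 * (n + 1 : ℕ)) : ℝ) * ⟪hermiteBasis (n + 1), (u : L2R)⟫_ℂ := by
  simp only [hermiteBasis_apply]
  exact inner_rotHermite_lowerOp _ (by simp) n u

lemma inner_hermiteBasis_raiseOp (n : ℕ) (u : formDomain) :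
    ⟪hermiteBasis n, raiseOp 0 u⟫_ℂ
      = (Real.sqrt (2 * n) : ℝ) * ⟪hermiteBasis (n - 1), (u : L2R)⟫_ℂ := by
  simp only [hermiteBasis_apply]
  exact inner_rotHermite_raiseOp _ (by simp) n u

/-! ### Norm identities and coercivity of the ladder operators -/

lemma norm_sqrt_mul_sq {x : ℝ} (hx : 0 ≤ x) (z : ℂ) :
    ‖((Real.sqrt x : ℝ) : ℂ) * z‖ ^ 2 = x * ‖z‖ ^ 2 := by
  rw [norm_mul, mul_pow, norm_real, Real.norm_eq_abs, sq_abs, Real.sq_sqrt hx]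

/-- Parseval for the raised function: its zeroth coefficient is zero, so the series may start at
index 1 and be shifted. -/
lemma hasSum_norm_raiseOp_sq (u : formDomain) :
    HasSum (fun n : ℕ => 2 * (n + 1 : ℝ) * ‖⟪hermiteBasis n, (u : L2R)⟫_ℂ‖ ^ 2)
      (‖raiseOp 0 u‖ ^ 2) := by
  have h := (hasSum_nat_add_iff' 1).2 (hermiteBasis.hasSum_norm_inner_sq (raiseOp 0 u))
  simp only [inner_hermiteBasis_raiseOp] at h
  have e : ∀ n : ℕ, (0 : ℝ) ≤ 2 * ((n + 1 : ℕ) : ℝ) := fun n => by positivity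
  simp only [norm_sqrt_mul_sq (e _)] at h
  simpa using h

lemma hasSum_norm_lowerOp_sq (u : formDomain) :
    HasSum (fun n : ℕ => 2 * (n : ℝ) * ‖⟪hermiteBasis n, (u : L2R)⟫_ℂ‖ ^ 2)
      (‖lowerOp 0 u‖ ^ 2) := by
  have h := hermiteBasis.hasSum_norm_inner_sq (lowerOp 0 u)
  simp only [inner_hermiteBasis_lowerOp] at h
  refine (hasSum_nat_add_iff' 1).1 ?_
  have e : ∀ n : ℕ, (0 : ℝ) ≤ 2 * ((n + 1 : ℕ) : ℝ) := fun n => by positivity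
  simp only [norm_sqrt_mul_sq (e _)] at h
  simpa using h

/-- The commutation relation in quadratic form, read off coefficientwise from 2(n+1) = 2n + 2. -/
lemma norm_raiseOp_sq (u : formDomain) :
    ‖raiseOp 0 u‖ ^ 2 = ‖lowerOp 0 u‖ ^ 2 + 2 * ‖(u : L2R)‖ ^ 2 := by
  refine (hasSum_norm_raiseOp_sq u).unique ?_
  refine ((hasSum_norm_lowerOp_sq u).add
    ((hermiteBasis.hasSum_norm_inner_sq (u : L2R)).mul_left 2)).congr_fun ?_
  intro n
  ring

/-- Morally an integration by parts of x(|u|²)'/2. Expanding the norms of u' ∓ xu in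
`norm_raiseOp_sq` gives it without a product rule for weakly differentiable functions. -/
lemma re_inner_weakDeriv_mulX (u : formDomain) :
    (⟪weakDeriv u, mulX u⟫_ℂ).re = -‖(u : L2R)‖ ^ 2 / 2 := by
  have hr : raiseOp 0 u = (-I) • (weakDeriv u - mulX u) := by
    simp [raiseOp, smul_sub]
  have hl : lowerOp 0 u = (-I) • (weakDeriv u + mulX u) := by
    simp [lowerOp, sub_eq_add_neg]
  have h := norm_raiseOp_sq u
  rw [hr, hl, norm_smul, norm_smul, norm_neg, norm_I, one_mul, one_mul,
    norm_sub_sq (𝕜 := ℂ), norm_add_sq (𝕜 := ℂ)] at h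
  simp only [RCLike.re_eq_complex_re] at h
  linarith

lemma abs_two_re_exp_mul_le (θ : ℝ) (s : ℂ) :
    |2 * (exp (I * θ) * s).re| ≤ 2 * |s.re| + 2 * |Real.sin θ| * ‖s‖ := by
  have e : (exp (I * θ) * s).re = Real.cos θ * s.re - Real.sin θ * s.im := by
    rw [mul_comm I, exp_mul_I, ← ofReal_cos, ← ofReal_sin]
    simp [-ofReal_cos, -ofReal_sin]
  rw [e, abs_mul, abs_two, mul_assoc, ← mul_add]
  refine mul_le_mul_of_nonneg_left ((abs_sub _ _).trans (add_le_add ?_ ?_)) zero_le_two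
  · rw [abs_mul]
    exact mul_le_of_le_one_left (abs_nonneg _) (Real.abs_cos_le_one θ)
  · rw [abs_mul]
    exact mul_le_mul_of_nonneg_left (abs_im_le_norm s) (abs_nonneg _)

lemma exp_half_mul_exp_half (θ : ℝ) : exp (I * θ / 2) * exp (I * θ / 2) = exp (I * θ) := by
  rw [← exp_add]; ring_nf

lemma norm_exp_half (θ : ℝ) : ‖exp (I * θ / 2)‖ = 1 := by
  rw [norm_exp]; simp

lemma norm_exp_neg_half (θ : ℝ) : ‖exp (-(I * θ / 2))‖ = 1 := by
  rw [norm_exp]; simp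

lemma conj_mul_phase (θ : ℝ) (s : ℂ) :
    (starRingEnd ℂ) (-I * exp (-(I * θ / 2))) * (I * exp (I * θ / 2) * s)
      = -(exp (I * θ) * s) := by
  rw [map_mul, map_neg, conj_I, conj_exp_neg_half, ← exp_half_mul_exp_half]
  linear_combination exp (I * θ / 2) * exp (I * θ / 2) * s * I_sq

/-- Here s stands for ⟨u', xu⟩ and a, b, n for the norms of u', xu, u. The real part of s is paid
for by n²; the rest costs at most 2|sin θ|ab ≤ |sin θ|(a² + b²). Only |t| enters, so one estimate
serves both ladder operators. -/
lemma coercive_aux {θ a b n t : ℝ} {s : ℂ} (hs : ‖s‖ ≤ a * b) (hre : s.re = -n ^ 2 / 2)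
    (ht : |t| ≤ |2 * (exp (I * θ) * s).re|) :
    (1 - |Real.sin θ|) * (a ^ 2 + b ^ 2) ≤ a ^ 2 + t + b ^ 2 + n ^ 2 := by
  have h1 := ht.trans (abs_two_re_exp_mul_le θ s)
  have h2 : |s.re| = n ^ 2 / 2 := by
    rw [hre, neg_div, abs_neg, abs_of_nonneg (by positivity)]
  have h3 := neg_abs_le t
  have h4 : 2 * |Real.sin θ| * ‖s‖ ≤ |Real.sin θ| * (a ^ 2 + b ^ 2) := by
    nlinarith [abs_nonneg (Real.sin θ), sq_nonneg (a - b), mul_le_mul_of_nonneg_left hs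
      (abs_nonneg (Real.sin θ)), mul_nonneg (abs_nonneg (Real.sin θ)) (sq_nonneg (a - b))]
  rw [h2] at h1
  linarith

lemma coercive_lowerOp (θ : ℝ) (u : formDomain) :
    (1 - |Real.sin θ|) * (‖weakDeriv u‖ ^ 2 + ‖mulX u‖ ^ 2)
      ≤ ‖lowerOp θ u‖ ^ 2 + ‖(u : L2R)‖ ^ 2 := by
  have e : lowerOp θ u = (-I * exp (-(I * θ / 2))) • weakDeriv u
      - (I * exp (I * θ / 2)) • mulX u := rfl
  rw [e, norm_sub_sq (𝕜 := ℂ), norm_smul, norm_smul, inner_smul_left, inner_smul_right]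
  simp only [norm_mul, norm_neg, norm_I, norm_exp_half, norm_exp_neg_half, one_mul]
  refine (coercive_aux (θ := θ) (norm_inner_le_norm _ _) (re_inner_weakDeriv_mulX u) ?_).trans_eq
    (by rw [sub_eq_add_neg])
  rw [abs_neg]
  refine le_of_eq ?_
  rw [conj_mul_phase, RCLike.re_eq_complex_re, neg_re, mul_neg, abs_neg]

lemma coercive_raiseOp (θ : ℝ) (u : formDomain) :
    (1 - |Real.sin θ|) * (‖weakDeriv u‖ ^ 2 + ‖mulX u‖ ^ 2)
      ≤ ‖raiseOp θ u‖ ^ 2 + ‖(u : L2R)‖ ^ 2 := by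
  have e : raiseOp θ u = (-I * exp (-(I * θ / 2))) • weakDeriv u
      + (I * exp (I * θ / 2)) • mulX u := rfl
  rw [e, norm_add_sq (𝕜 := ℂ), norm_smul, norm_smul, inner_smul_left, inner_smul_right]
  simp only [norm_mul, norm_neg, norm_I, norm_exp_half, norm_exp_neg_half, one_mul]
  refine coercive_aux (θ := θ) (norm_inner_le_norm _ _) (re_inner_weakDeriv_mulX u) ?_
  refine le_of_eq ?_
  rw [conj_mul_phase, RCLike.re_eq_complex_re, neg_re, mul_neg, abs_neg]

/-! ### Compact embedding of the form domain -/

lemma inner_hermiteBasis_sub_sum (u : L2R) (N n : ℕ) :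
    ⟪hermiteBasis n, u - ∑ i : Fin N, ⟪hermiteBasis i, u⟫_ℂ • hermiteBasis i⟫_ℂ
      = if n < N then 0 else ⟪hermiteBasis n, u⟫_ℂ := by
  have ho := orthonormal_iff_ite.1 hermiteBasis.orthonormal
  simp only [inner_sub_right, inner_sum, inner_smul_right, ho]
  split_ifs with hn
  · rw [Finset.sum_eq_single ⟨n, hn⟩]
    · simp
    · intro b _ hb
      have : n ≠ b := fun h => hb (Fin.ext h.symm)
      simp [this]
    · simp
  · rw [Finset.sum_eq_zero, sub_zero]
    intro i _
    have : n ≠ i := by have := i.2; omega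
    simp [this]

/-- Coefficients of index at least N carry a weight of at least 2(N+1) in the norm of the raised
function, so Hermite truncation converges uniformly on bounded sets of the form norm. -/
lemma norm_sub_sum_hermiteBasis_sq_le (u : formDomain) (N : ℕ) :
    2 * (N + 1 : ℝ) * ‖(u : L2R) - ∑ i : Fin N, ⟪hermiteBasis i, (u : L2R)⟫_ℂ • hermiteBasis i‖ ^ 2
      ≤ ‖raiseOp 0 u‖ ^ 2 := by
  refine hasSum_le (fun n => ?_) ((hermiteBasis.hasSum_norm_inner_sq _).mul_left _)
    (hasSum_norm_raiseOp_sq u)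
  rw [inner_hermiteBasis_sub_sum]
  split_ifs with h
  · simp; positivity
  · have : (N : ℝ) ≤ n := by exact_mod_cast not_lt.1 h
    gcongr

/-- The compactness of the embedding of the form domain into `L²(ℝ)`. -/
lemma totallyBounded_formDomain (M : ℝ) :
    TotallyBounded {v : L2R | ∃ u : formDomain, (u : L2R) = v ∧ ‖v‖ ≤ 1 ∧ ‖raiseOp 0 u‖ ≤ M} := by
  rw [Metric.totallyBounded_iff]
  intro ε hε
  -- This N makes the truncation error less than ε/2; the truncations themselves lie in the image of
  -- a compact ball of ℂᴺ, where a finite ε/2-net exists.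
  obtain ⟨N, hN⟩ := exists_nat_gt (M ^ 2 / (ε / 2) ^ 2)
  let L : (Fin N → ℂ) → L2R := fun c => ∑ i : Fin N, c i • hermiteBasis i
  have hL : Continuous L := by fun_prop
  have hK : IsCompact (L '' Metric.closedBall 0 1) := (isCompact_closedBall 0 1).image hL
  obtain ⟨t, ht, htc⟩ := Metric.totallyBounded_iff.1 hK.totallyBounded (ε / 2) (by positivity)
  refine ⟨t, ht, ?_⟩
  rintro _ ⟨u, rfl, hu1, huM⟩
  have hmem : L (fun i => ⟪hermiteBasis i, (u : L2R)⟫_ℂ) ∈ L '' Metric.closedBall 0 1 := by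
    refine ⟨_, ?_, rfl⟩
    rw [mem_closedBall_zero_iff, pi_norm_le_iff_of_nonneg zero_le_one]
    intro i
    refine (norm_inner_le_norm _ _).trans ?_
    rw [hermiteBasis.orthonormal.1, one_mul]
    exact hu1
  obtain ⟨y, hy, hyd⟩ := Set.mem_iUnion₂.1 (htc hmem)
  refine Set.mem_iUnion₂.2 ⟨y, hy, ?_⟩
  rw [Metric.mem_ball] at hyd ⊢
  have hdist : dist (u : L2R) (L fun i => ⟪hermiteBasis i, (u : L2R)⟫_ℂ) < ε / 2 := by
    rw [dist_eq_norm]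
    have h1 := norm_sub_sum_hermiteBasis_sq_le u N
    change 2 * (N + 1 : ℝ) * ‖(u : L2R) - L fun i => ⟪hermiteBasis i, (u : L2R)⟫_ℂ‖ ^ 2 ≤ _ at h1
    set d := ‖(u : L2R) - L fun i => ⟪hermiteBasis i, (u : L2R)⟫_ℂ‖ with hd
    have hd0 : 0 ≤ d := norm_nonneg _
    have h2 : ‖raiseOp 0 u‖ ^ 2 ≤ M ^ 2 := pow_le_pow_left₀ (norm_nonneg _) huM 2
    rw [div_lt_iff₀ (by positivity)] at hN
    by_contra! hlt
    have h3 : (ε / 2) ^ 2 ≤ d ^ 2 := pow_le_pow_left₀ (by positivity) hlt 2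
    have h4 : (N : ℝ) * (ε / 2) ^ 2 ≤ N * d ^ 2 := by gcongr
    nlinarith [sq_nonneg d, mul_nonneg (Nat.cast_nonneg (α := ℝ) N) (sq_nonneg d)]
  calc dist (u : L2R) y ≤ _ := dist_triangle _ _ _
    _ < ε / 2 + ε / 2 := add_lt_add hdist hyd
    _ = ε := add_halves ε

/-! ### Weak derivatives and products with x under L² limits -/

lemma tendsto_integral_smul {φ : ℝ → ℝ} (hφ : MemLp φ 2 volume) {u : ℕ → L2R} {v : L2R}
    (hu : Tendsto u atTop (𝓝 v)) :
    Tendsto (fun k => ∫ x, φ x • u k x) atTop (𝓝 (∫ x, φ x • v x)) := by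
  have hφ' : MemLp (fun x => (φ x : ℂ)) 2 volume := hφ.ofReal
  have e : ∀ w : L2R, ∫ x, φ x • w x = ⟪hφ'.toLp _, w⟫_ℂ := fun w => by
    rw [L2.inner_def]
    refine integral_congr_ae ?_
    filter_upwards [hφ'.coeFn_toLp] with x hx
    rw [hx, RCLike.inner_apply, conj_ofReal, real_smul, mul_comm]
  simp only [e]
  exact (tendsto_const_nhds (x := hφ'.toLp _)).inner (𝕜 := ℂ) hu

lemma IsWeakDeriv.of_tendsto {u g : ℕ → L2R} {v k : L2R} (h : ∀ n, IsWeakDeriv (u n) (g n))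
    (hu : Tendsto u atTop (𝓝 v)) (hg : Tendsto g atTop (𝓝 k)) : IsWeakDeriv v k := by
  intro φ hφ hc
  have hd : Continuous (deriv φ) := hφ.continuous_deriv (by simp)
  have h1 := tendsto_integral_smul (hd.memLp_of_hasCompactSupport hc.deriv) hu
  have h2 := (tendsto_integral_smul (hφ.continuous.memLp_of_hasCompactSupport hc) hg).neg
  exact tendsto_nhds_unique h1 (h2.congr fun n => (h n φ hφ hc).symm)

/-- Testing against φ moves the unbounded factor onto the compactly supported function xφ, so both
sides are continuous in the L² norm. -/
lemma IsMulX.of_tendsto {u g : ℕ → L2R} {v k : L2R} (h : ∀ n, IsMulX (u n) (g n))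
    (hu : Tendsto u atTop (𝓝 v)) (hg : Tendsto g atTop (𝓝 k)) : IsMulX v k := by
  have hloc : LocallyIntegrable (fun x : ℝ => (x : ℂ) * v x) volume :=
    ((Lp.memLp v).locallyIntegrable (by norm_num)).continuous_smul continuous_ofReal
  refine ae_eq_of_integral_contDiff_smul_eq
    ((Lp.memLp k).locallyIntegrable (by norm_num)) hloc fun φ hφ hc => ?_
  have hxφ : Continuous (fun x => φ x * x) := hφ.continuous.mul continuous_id
  have h1 := tendsto_integral_smul (hφ.continuous.memLp_of_hasCompactSupport hc) hg
  have h2 := tendsto_integral_smul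
    (hxφ.memLp_of_hasCompactSupport (p := 2) (μ := volume) hc.mul_right) hu
  have e : ∀ n, ∫ x, (φ x * x) • u n x = ∫ x, φ x • g n x := fun n => by
    refine integral_congr_ae ?_
    filter_upwards [h n] with x hx
    rw [hx, mul_smul, real_smul (x := x)]
  rw [tendsto_nhds_unique h1 (h2.congr e)]
  refine integral_congr_ae (Eventually.of_forall fun x => ?_)
  simp only [mul_smul, real_smul]

end HermiteBasis

/-! ### Operators with a complete biorthonormal system of eigenvectors -/

section Eigensystem

open Filter Topology

variable {E ι : Type*} [NormedAddCommGroup E] [InnerProductSpace ℂ E]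

/-- `χ` is a family of eigenvectors of `T` with eigenvalues `ev`, and `w` is a biorthonormal
family of eigenvectors of the formal adjoint of `T`; both families are total. -/
structure BiorthonormalEigensystem (T : E →ₗ.[ℂ] E) (ev : ι → ℂ) (χ w : ι → E) : Prop where
  eigen : ∀ a, ∃ h : χ a ∈ T.domain, T ⟨χ a, h⟩ = ev a • χ a
  dual : ∀ a (u : T.domain), ⟪w a, T u⟫_ℂ = ev a * ⟪w a, (u : E)⟫_ℂ
  biorth_self : ∀ a, ⟪w a, χ a⟫_ℂ = 1
  biorth_ne : ∀ a b, a ≠ b → ⟪w a, χ b⟫_ℂ = 0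
  total : ∀ u : E, (∀ a, ⟪χ a, u⟫_ℂ = 0) → u = 0
  total_dual : ∀ u : E, (∀ a, ⟪w a, u⟫_ℂ = 0) → u = 0
  finite_fiber : ∀ z, {a | ev a = z}.Finite

namespace BiorthonormalEigensystem

variable {T : E →ₗ.[ℂ] E} {ev : ι → ℂ} {χ w : ι → E}

lemma ne_zero (h : BiorthonormalEigensystem T ev χ w) (a : ι) : χ a ≠ 0 := fun h0 => by
  have := h.biorth_self a
  rw [h0, inner_zero_right] at this
  exact zero_ne_one this

lemma linearIndependent (h : BiorthonormalEigensystem T ev χ w) : LinearIndependent ℂ χ := by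
  rw [linearIndependent_iff']
  intro s c hc a ha
  have h1 : ⟪w a, ∑ b ∈ s, c b • χ b⟫_ℂ = c a := by
    rw [inner_sum, Finset.sum_eq_single a]
    · rw [inner_smul_right, h.biorth_self, mul_one]
    · intro b _ hb
      rw [inner_smul_right, h.biorth_ne a b hb.symm, mul_zero]
    · exact fun h => absurd ha h
  rw [← h1, hc, inner_zero_right]

/-- Subtracting the biorthogonal projection onto the fibre of z, a finite sum because fibres are
finite, leaves a vector orthogonal to the whole dual family; totality makes it zero. No convergence
of expansions is involved. -/
lemma mem_span_of_inner_eq_zero (h : BiorthonormalEigensystem T ev χ w) {z : ℂ} {u : E}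
    (hu : ∀ a, ev a ≠ z → ⟪w a, u⟫_ℂ = 0) : u ∈ Submodule.span ℂ (χ '' {a | ev a = z}) := by
  classical
  set s := (h.finite_fiber z).toFinset with hs
  have hmem : ∀ a, a ∈ s ↔ ev a = z := fun a => by simp [hs]
  have h0 : u - ∑ b ∈ s, ⟪w b, u⟫_ℂ • χ b = 0 := by
    refine h.total_dual _ fun a => ?_
    rw [inner_sub_right, inner_sum]
    by_cases ha : ev a = z
    · rw [Finset.sum_eq_single a]
      · rw [inner_smul_right, h.biorth_self, mul_one, sub_self]
      · intro b _ hb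
        rw [inner_smul_right, h.biorth_ne a b hb.symm, mul_zero]
      · exact fun h => absurd ((hmem a).2 ha) h
    · rw [hu a ha, Finset.sum_eq_zero, sub_zero]
      intro b hb
      rw [inner_smul_right, h.biorth_ne, mul_zero]
      rintro rfl
      exact ha ((hmem _).1 hb)
  rw [sub_eq_zero.1 h0]
  exact Submodule.sum_mem _ fun b hb =>
    Submodule.smul_mem _ _ (Submodule.subset_span ⟨b, (hmem b).1 hb, rfl⟩)

/-- Pairing (T - z)u with w a multiplies ⟨w a, u⟩ by the nonzero number ev a - z, so vanishing
passes from one power to the next. -/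
lemma inner_eq_zero_of_mem_genEigenspace (h : BiorthonormalEigensystem T ev χ w) {z : ℂ} {a : ι}
    (ha : ev a ≠ z) (k : ℕ) : ∀ u ∈ genEigenspace T z k, ⟪w a, u⟫_ℂ = 0 := by
  induction k with
  | zero =>
    intro u hu
    rw [(Submodule.mem_bot ℂ).1 hu, inner_zero_right]
  | succ k ih =>
    rintro _ ⟨u, hu, rfl⟩
    have h1 : ⟪w a, T u - z • (u : E)⟫_ℂ = 0 := ih _ hu
    rw [inner_sub_right, inner_smul_right, h.dual, ← sub_mul] at h1
    exact (mul_eq_zero.1 h1).resolve_left (sub_ne_zero.2 ha)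

lemma eigenspaceOf_eq_genEigenspace_one (T : E →ₗ.[ℂ] E) (z : ℂ) :
    eigenspaceOf T z = genEigenspace T z 1 := rfl

theorem eigenspaceOf_eq (h : BiorthonormalEigensystem T ev χ w) (z : ℂ) :
    eigenspaceOf T z = Submodule.span ℂ (χ '' {a | ev a = z}) := by
  refine le_antisymm (fun u hu => ?_) (Submodule.span_le.2 ?_)
  · exact h.mem_span_of_inner_eq_zero fun a ha =>
      h.inner_eq_zero_of_mem_genEigenspace ha 1 u hu
  · rintro _ ⟨a, rfl, rfl⟩
    obtain ⟨hd, he⟩ := h.eigen a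
    refine ⟨⟨χ a, hd⟩, ?_, rfl⟩
    rw [SetLike.mem_coe, LinearMap.mem_ker]
    exact sub_eq_zero.2 he

theorem rootSubspace_eq (h : BiorthonormalEigensystem T ev χ w) (z : ℂ) :
    rootSubspace T z = eigenspaceOf T z := by
  refine le_antisymm (iSup_le fun k u hu => ?_) ?_
  · rw [h.eigenspaceOf_eq]
    exact h.mem_span_of_inner_eq_zero fun a ha =>
      h.inner_eq_zero_of_mem_genEigenspace ha k u hu
  · rw [eigenspaceOf_eq_genEigenspace_one]
    exact le_iSup (genEigenspace T z) 1

theorem algMultiplicity_eq (h : BiorthonormalEigensystem T ev χ w) (z : ℂ) :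
    algMultiplicity T z = geomMultiplicity T z := by
  rw [algMultiplicity, h.rootSubspace_eq, geomMultiplicity]

lemma geomMultiplicity_eq_of_fiber_eq_singleton (h : BiorthonormalEigensystem T ev χ w) {z : ℂ}
    {a : ι} (hf : {x | ev x = z} = {a}) : geomMultiplicity T z = 1 := by
  rw [geomMultiplicity, h.eigenspaceOf_eq, hf, rank_span_set, Set.image_singleton,
    Cardinal.mk_singleton]
  rw [← hf]
  exact (h.linearIndependent.linearIndepOn_id).mono (Set.image_subset_range _ _)

lemma geomMultiplicity_eq_of_fiber_eq_pair (h : BiorthonormalEigensystem T ev χ w) {z : ℂ}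
    {a b : ι} (hab : a ≠ b) (hf : {x | ev x = z} = {a, b}) : geomMultiplicity T z = 2 := by
  rw [geomMultiplicity, h.eigenspaceOf_eq, hf, rank_span_set, Set.image_pair,
    Cardinal.mk_insert (by simpa using h.linearIndependent.injective.ne hab),
    Cardinal.mk_singleton, one_add_one_eq_two]
  rw [← hf]
  exact (h.linearIndependent.linearIndepOn_id).mono (Set.image_subset_range _ _)

lemma eq_zero_of_apply_eq_smul (h : BiorthonormalEigensystem T ev χ w) {z : ℂ}
    (hz : ∀ a, ev a ≠ z) (u : T.domain) (hu : T u = z • (u : E)) : (u : E) = 0 := by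
  refine h.total_dual _ fun a => ?_
  have h1 := h.dual a u
  rw [hu, inner_smul_right] at h1
  have h2 : (ev a - z) * ⟪w a, (u : E)⟫_ℂ = 0 := by rw [sub_mul, h1, sub_self]
  exact (mul_eq_zero.1 h2).resolve_left (sub_ne_zero.2 (hz a))

/-- Otherwise there are unit vectors with (T - z)vₖ → 0. Compactness gives a limit of norm 1, and
closedness turns it into an eigenvector for z, which is excluded. -/
lemma exists_norm_le (h : BiorthonormalEigensystem T ev χ w)
    (hcl : ∀ (u : ℕ → T.domain) (v y : E), Tendsto (fun k => (u k : E)) atTop (𝓝 v) →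
      Tendsto (fun k => T (u k)) atTop (𝓝 y) → ∃ hv : v ∈ T.domain, T ⟨v, hv⟩ = y)
    (hcpt : ∀ (u : ℕ → T.domain) (M : ℝ), (∀ k, ‖(u k : E)‖ ≤ 1) → (∀ k, ‖T (u k)‖ ≤ M) →
      ∃ (v : E) (φ : ℕ → ℕ), StrictMono φ ∧ Tendsto (fun k => (u (φ k) : E)) atTop (𝓝 v))
    {z : ℂ} (hz : ∀ a, ev a ≠ z) :
    ∃ c : ℝ, 0 < c ∧ ∀ u : T.domain, c * ‖(u : E)‖ ≤ ‖T u - z • (u : E)‖ := by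
  by_contra! hcon
  have hex : ∀ k : ℕ, ∃ v : T.domain, ‖(v : E)‖ = 1 ∧ ‖T v - z • (v : E)‖ ≤ 1 / ((k : ℝ) + 1) := by
    intro k
    obtain ⟨u, hu⟩ := hcon (1 / ((k : ℝ) + 1)) (by positivity)
    have hu0 : ‖(u : E)‖ ≠ 0 := fun h0 => by
      rw [h0, mul_zero] at hu
      exact absurd hu (not_lt.2 (norm_nonneg _))
    refine ⟨((‖(u : E)‖⁻¹ : ℝ) : ℂ) • u, ?_, ?_⟩
    · rw [Submodule.coe_smul, norm_smul, norm_real, norm_inv, norm_norm, inv_mul_cancel₀ hu0]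
    · rw [T.map_smul, Submodule.coe_smul, smul_comm z, ← smul_sub, norm_smul, norm_real, norm_inv,
        norm_norm, inv_mul_le_iff₀ (by positivity), mul_comm]
      exact hu.le
  choose v hv1 hv2 using hex
  have hb : ∀ k, ‖T (v k)‖ ≤ 1 + ‖z‖ := fun k => by
    have h1 : ‖T (v k) - z • (v k : E)‖ ≤ 1 :=
      (hv2 k).trans (by
        rw [div_le_one (by positivity)]
        linarith [(Nat.cast_nonneg k : (0 : ℝ) ≤ k)])
    calc ‖T (v k)‖ = ‖(T (v k) - z • (v k : E)) + z • (v k : E)‖ := by rw [sub_add_cancel]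
      _ ≤ _ := norm_add_le _ _
      _ ≤ 1 + ‖z‖ := by rw [norm_smul, hv1, mul_one]; linarith
  obtain ⟨x, φ, hφ, hx⟩ := hcpt v (1 + ‖z‖) (fun k => (hv1 k).le) hb
  have h0 : Tendsto (fun k => T (v (φ k)) - z • (v (φ k) : E)) atTop (𝓝 0) :=
    (squeeze_zero_norm hv2 tendsto_one_div_add_atTop_nhds_zero_nat).comp hφ.tendsto_atTop
  have hT : Tendsto (fun k => T (v (φ k))) atTop (𝓝 (z • x)) := by
    simpa using h0.add (hx.const_smul z)
  obtain ⟨hxd, hxT⟩ := hcl (fun k => v (φ k)) x _ hx hT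
  have hx0 : x = 0 := h.eq_zero_of_apply_eq_smul hz ⟨x, hxd⟩ hxT
  have hn : ‖x‖ = 1 := tendsto_nhds_unique hx.norm (by simp [hv1])
  rw [hx0, norm_zero] at hn
  exact zero_ne_one hn

theorem memResolventSet [CompleteSpace E] (h : BiorthonormalEigensystem T ev χ w)
    (hcl : ∀ (u : ℕ → T.domain) (v y : E), Tendsto (fun k => (u k : E)) atTop (𝓝 v) →
      Tendsto (fun k => T (u k)) atTop (𝓝 y) → ∃ hv : v ∈ T.domain, T ⟨v, hv⟩ = y)
    (hcpt : ∀ (u : ℕ → T.domain) (M : ℝ), (∀ k, ‖(u k : E)‖ ≤ 1) → (∀ k, ‖T (u k)‖ ≤ M) →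
      ∃ (v : E) (φ : ℕ → ℕ), StrictMono φ ∧ Tendsto (fun k => (u (φ k) : E)) atTop (𝓝 v))
    {z : ℂ} (hz : ∀ a, ev a ≠ z) : MemResolventSet T z := by
  obtain ⟨c, hc, hbound⟩ := h.exists_norm_le hcl hcpt hz
  let S : T.domain →ₗ[ℂ] E := T.toFun - z • T.domain.subtype
  have hS : ∀ u, S u = T u - z • (u : E) := fun _ => rfl
  have hinj : Function.Injective S := by
    rw [← LinearMap.ker_eq_bot, LinearMap.ker_eq_bot']
    intro u hu
    exact Subtype.ext (h.eq_zero_of_apply_eq_smul hz u (sub_eq_zero.1 hu))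
  -- The lower bound makes preimages of a convergent sequence Cauchy, and closedness of T identifies
  -- the limit.
  have hclosed : IsClosed (LinearMap.range S : Set E) := by
    refine IsSeqClosed.isClosed fun y y₀ hy hy₀ => ?_
    choose u hu using hy
    have hcauchy : CauchySeq fun k => (u k : E) := by
      have hyc := hy₀.cauchySeq
      rw [Metric.cauchySeq_iff] at hyc ⊢
      intro ε hε
      obtain ⟨N, hN⟩ := hyc (c * ε) (by positivity)
      refine ⟨N, fun p hp q hq => ?_⟩
      have h1 := hN p hp q hq
      have h2 := hbound (u p - u q)
      rw [← hS, map_sub, hu, hu, ← dist_eq_norm, Submodule.coe_sub, ← dist_eq_norm] at h2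
      exact lt_of_mul_lt_mul_left (h2.trans_lt h1) hc.le
    obtain ⟨v, hv⟩ := cauchySeq_tendsto_of_complete hcauchy
    have hT : Tendsto (fun k => T (u k)) atTop (𝓝 (y₀ + z • v)) := by
      refine (hy₀.add (hv.const_smul z)).congr fun k => ?_
      rw [← hu, hS, sub_add_cancel]
    obtain ⟨hvd, hvT⟩ := hcl u v _ hv hT
    exact ⟨⟨v, hvd⟩, by rw [hS, hvT, add_sub_cancel_right]⟩
  -- The closed range contains (ev a - z) χ a for every a, so a vector orthogonal to it is
  -- orthogonal to the total family χ.
  have hrange : LinearMap.range S = ⊤ := by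
    rw [← hclosed.submodule_topologicalClosure_eq, Submodule.topologicalClosure_eq_top_iff,
      Submodule.eq_bot_iff]
    intro y hy
    refine h.total y fun a => ?_
    obtain ⟨hd, he⟩ := h.eigen a
    have h1 := (Submodule.mem_orthogonal _ _).1 hy (S ⟨χ a, hd⟩) ⟨_, rfl⟩
    rw [hS, he, ← sub_smul, inner_smul_left] at h1
    exact (mul_eq_zero.1 h1).resolve_left ((map_ne_zero _).2 (sub_ne_zero.2 (hz a)))
  let e := LinearEquiv.ofBijective S ⟨hinj, LinearMap.range_eq_top.1 hrange⟩
  have he : ∀ v, S (e.symm v) = v := fun v => e.apply_symm_apply v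
  refine ⟨(T.domain.subtype ∘ₗ e.symm.toLinearMap).mkContinuous c⁻¹ fun v => ?_, fun v => ?_,
    fun u => ?_⟩
  · have h1 := hbound (e.symm v)
    rw [← hS, he] at h1
    rw [inv_mul_eq_div, le_div_iff₀ hc, mul_comm]
    exact h1
  · exact ⟨(e.symm v).2, he v⟩
  · exact congrArg Subtype.val (e.symm_apply_apply u)

theorem unboundedSpectrum_eq [CompleteSpace E] (h : BiorthonormalEigensystem T ev χ w)
    (hcl : ∀ (u : ℕ → T.domain) (v y : E), Tendsto (fun k => (u k : E)) atTop (𝓝 v) →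
      Tendsto (fun k => T (u k)) atTop (𝓝 y) → ∃ hv : v ∈ T.domain, T ⟨v, hv⟩ = y)
    (hcpt : ∀ (u : ℕ → T.domain) (M : ℝ), (∀ k, ‖(u k : E)‖ ≤ 1) → (∀ k, ‖T (u k)‖ ≤ M) →
      ∃ (v : E) (φ : ℕ → ℕ), StrictMono φ ∧ Tendsto (fun k => (u (φ k) : E)) atTop (𝓝 v)) :
    unboundedSpectrum T = Set.range ev := by
  ext z
  refine ⟨fun hz => ?_, ?_⟩
  · by_contra hne
    exact hz (h.memResolventSet hcl hcpt fun a ha => hne ⟨a, ha⟩)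
  · rintro ⟨a, rfl⟩ ⟨R, -, hR⟩
    obtain ⟨hd, he⟩ := h.eigen a
    have := hR ⟨χ a, hd⟩
    rw [he, sub_self, map_zero] at this
    exact h.ne_zero a this.symm

end BiorthonormalEigensystem

end Eigensystem

/-! ### Closedness of the ladder operators -/

section Closedness

open Filter Topology

lemma cauchySeq_of_sq_le {E F : Type*} [NormedAddCommGroup E] [NormedAddCommGroup F]
    {f : ℕ → E} {g g' : ℕ → F} {K : ℝ} (hK : 0 < K) (hg : CauchySeq g) (hg' : CauchySeq g')
    (h : ∀ p q, K * ‖f p - f q‖ ^ 2 ≤ ‖g p - g q‖ ^ 2 + ‖g' p - g' q‖ ^ 2) : CauchySeq f := by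
  rw [Metric.cauchySeq_iff] at hg hg' ⊢
  intro ε hε
  -- With √(K/2)·ε for each of the two sequences, their squares add up to Kε².
  obtain ⟨N, hN⟩ := hg (Real.sqrt (K / 2) * ε) (by positivity)
  obtain ⟨N', hN'⟩ := hg' (Real.sqrt (K / 2) * ε) (by positivity)
  refine ⟨max N N', fun p hp q hq => ?_⟩
  have h1 := hN p (le_of_max_le_left hp) q (le_of_max_le_left hq)
  have h2 := hN' p (le_of_max_le_right hp) q (le_of_max_le_right hq)
  have h3 := h p q
  rw [dist_eq_norm] at h1 h2 ⊢
  have e : (Real.sqrt (K / 2) * ε) ^ 2 = K / 2 * ε ^ 2 := by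
    rw [mul_pow, Real.sq_sqrt (by positivity)]
  have h4 := pow_lt_pow_left₀ h1 (norm_nonneg _) two_ne_zero
  have h5 := pow_lt_pow_left₀ h2 (norm_nonneg _) two_ne_zero
  rw [e] at h4 h5
  refine lt_of_pow_lt_pow_left₀ 2 hε.le ?_
  refine lt_of_mul_lt_mul_left (a := K) ?_ hK.le
  linarith

/-- Coercivity applied to differences makes u' and xu converge separately, and each of these two
operations is closed. Without it the two parts of A could diverge and cancel. -/
lemma exists_apply_eq_of_tendsto {A : formDomain →ₗ[ℂ] L2R} {α β : ℂ} {K : ℝ} (hK : 0 < K)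
    (hA : A = α • weakDeriv + β • mulX)
    (hco : ∀ u, K * (‖weakDeriv u‖ ^ 2 + ‖mulX u‖ ^ 2) ≤ ‖A u‖ ^ 2 + ‖(u : L2R)‖ ^ 2)
    {u : ℕ → formDomain} {v y : L2R} (hu : Tendsto (fun k => (u k : L2R)) atTop (𝓝 v))
    (hAu : Tendsto (fun k => A (u k)) atTop (𝓝 y)) :
    ∃ hv : v ∈ formDomain, A ⟨v, hv⟩ = y := by
  have hsub : ∀ p q, K * (‖weakDeriv (u p) - weakDeriv (u q)‖ ^ 2 + ‖mulX (u p) - mulX (u q)‖ ^ 2)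
      ≤ ‖A (u p) - A (u q)‖ ^ 2 + ‖(u p : L2R) - u q‖ ^ 2 := fun p q => by
    have := hco (u p - u q)
    rwa [map_sub, map_sub, map_sub, Submodule.coe_sub] at this
  have c1 : CauchySeq fun k => weakDeriv (u k) :=
    cauchySeq_of_sq_le hK hAu.cauchySeq hu.cauchySeq fun p q => by
      refine le_trans ?_ (hsub p q)
      rw [mul_add]
      exact le_add_of_nonneg_right (by positivity)
  have c2 : CauchySeq fun k => mulX (u k) :=
    cauchySeq_of_sq_le hK hAu.cauchySeq hu.cauchySeq fun p q => by
      refine le_trans ?_ (hsub p q)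
      rw [mul_add]
      exact le_add_of_nonneg_left (by positivity)
  obtain ⟨g, hg⟩ := cauchySeq_tendsto_of_complete c1
  obtain ⟨g', hg'⟩ := cauchySeq_tendsto_of_complete c2
  have d1 : IsWeakDeriv v g := IsWeakDeriv.of_tendsto (fun k => weakDeriv_spec (u k)) hu hg
  have d2 : IsMulX v g' := IsMulX.of_tendsto (fun k => mulX_spec (u k)) hu hg'
  have hv : v ∈ formDomain := ⟨⟨g, d1⟩, g', d2⟩
  refine ⟨hv, ?_⟩
  have e1 : weakDeriv ⟨v, hv⟩ = g := (weakDeriv_spec _).unique d1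
  have e2 : mulX ⟨v, hv⟩ = g' := (mulX_spec _).unique d2
  refine tendsto_nhds_unique ?_ hAu
  subst hA
  simp only [LinearMap.add_apply, LinearMap.smul_apply, e1, e2]
  exact (hg.const_smul α).add (hg'.const_smul β)

variable {θ : ℝ}

lemma one_sub_abs_sin_pos (hθ : |θ| < Real.pi / 2) : 0 < 1 - |Real.sin θ| := by
  have hc : 0 < Real.cos θ := Real.cos_pos_of_mem_Ioo (abs_lt.mp hθ)
  have h1 := Real.sin_sq_add_cos_sq θ
  have h2 : |Real.sin θ| < 1 := by
    rw [← sq_lt_one_iff_abs_lt_one]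
    nlinarith
  linarith

lemma exists_lowerOp_eq_of_tendsto (hθ : |θ| < Real.pi / 2) {u : ℕ → formDomain} {v y : L2R}
    (hu : Tendsto (fun k => (u k : L2R)) atTop (𝓝 v))
    (hAu : Tendsto (fun k => lowerOp θ (u k)) atTop (𝓝 y)) :
    ∃ hv : v ∈ formDomain, lowerOp θ ⟨v, hv⟩ = y :=
  exists_apply_eq_of_tendsto (one_sub_abs_sin_pos hθ) (β := -(I * exp (I * θ / 2)))
    (by rw [lowerOp, sub_eq_add_neg, ← neg_smul]) (coercive_lowerOp θ) hu hAu

lemma exists_raiseOp_eq_of_tendsto (hθ : |θ| < Real.pi / 2) {u : ℕ → formDomain} {v y : L2R}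
    (hu : Tendsto (fun k => (u k : L2R)) atTop (𝓝 v))
    (hAu : Tendsto (fun k => raiseOp θ (u k)) atTop (𝓝 y)) :
    ∃ hv : v ∈ formDomain, raiseOp θ ⟨v, hv⟩ = y :=
  exists_apply_eq_of_tendsto (one_sub_abs_sin_pos hθ) rfl (coercive_raiseOp θ) hu hAu

/-- A bound for `raiseOp 0 u` in terms of any operator controlling the form norm. -/
lemma norm_raiseOp_zero_le {K M : ℝ} (hK : 0 < K) {u : formDomain}
    (h : K * (‖weakDeriv u‖ ^ 2 + ‖mulX u‖ ^ 2) ≤ M) :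
    ‖raiseOp 0 u‖ ≤ 1 + M / K := by
  have e : raiseOp 0 u = (-I) • weakDeriv u + I • mulX u := by simp [raiseOp]
  have h1 : ‖raiseOp 0 u‖ ≤ ‖weakDeriv u‖ + ‖mulX u‖ := by
    rw [e]
    refine (norm_add_le _ _).trans_eq ?_
    rw [norm_smul, norm_smul, norm_neg, norm_I, one_mul, one_mul]
  have h2 : ‖weakDeriv u‖ ^ 2 + ‖mulX u‖ ^ 2 ≤ M / K := by
    rw [le_div_iff₀ hK, mul_comm]; exact h
  -- A crude a + b ≤ 1 + a² + b² suffices, since only some bound is needed for compactness.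
  nlinarith [sq_nonneg (‖weakDeriv u‖ - 1), sq_nonneg (‖mulX u‖ - 1)]

end Closedness

/-! ### The Dirac operator in terms of the ladder operators -/

section Dirac

open Filter Topology

variable {θ m : ℝ}

/-- In each row the nonzero entries of α₁ and α₂ share one column, so the derivative and the factor
x merge into a single ladder operator: raising in rows 0 and 2, lowering in rows 1 and 3. -/
lemma diracOp_apply_zero (Ψ : diracDomain) :
    (diracOp θ m Ψ) 0
      = (m : ℂ) • (diracComponent 2 Ψ : L2R) + raiseOp θ (diracComponent 3 Ψ) := by
  simp [diracOp, raiseOp, Fin.sum_univ_four, diracAlpha1, diracAlpha2, diracAlpha3]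
  abel

lemma diracOp_apply_one (Ψ : diracDomain) :
    (diracOp θ m Ψ) 1
      = lowerOp θ (diracComponent 2 Ψ) - (m : ℂ) • (diracComponent 3 Ψ : L2R) := by
  simp [diracOp, lowerOp, Fin.sum_univ_four, diracAlpha1, diracAlpha2, diracAlpha3]
  abel

lemma diracOp_apply_two (Ψ : diracDomain) :
    (diracOp θ m Ψ) 2
      = (m : ℂ) • (diracComponent 0 Ψ : L2R) + raiseOp θ (diracComponent 1 Ψ) := by
  simp [diracOp, raiseOp, Fin.sum_univ_four, diracAlpha1, diracAlpha2, diracAlpha3]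
  abel

lemma diracOp_apply_three (Ψ : diracDomain) :
    (diracOp θ m Ψ) 3
      = lowerOp θ (diracComponent 0 Ψ) - (m : ℂ) • (diracComponent 1 Ψ : L2R) := by
  simp [diracOp, lowerOp, Fin.sum_univ_four, diracAlpha1, diracAlpha2, diracAlpha3]
  abel

lemma real_smul_eq (r : ℝ) (u : L2R) : r • u = (r : ℂ) • u := (algebraMap_smul ℂ r u).symm

lemma diracEnergy_sq (m : ℝ) (n : ℕ) : diracEnergy m n ^ 2 = 2 * n + m ^ 2 :=
  Real.sq_sqrt (by positivity)

lemma diracCoeffRaw_ne_zero (m : ℝ) (n : ℕ) (j : Fin 4) : diracCoeffRaw m (n + 1) j ≠ 0 := by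
  intro h
  have h0 : diracCoeffRaw m (n + 1) j 0 = 0 := by rw [h]; rfl
  have hs : Real.sqrt (n + 1) ≠ 0 := by positivity
  fin_cases j <;> simp [diracCoeffRaw] at h0 <;> exact hs h0

/-- With s = √(2(n+1)) and E the energy, everything follows from E² = s² + m². -/
lemma diracCoeffRaw_inner (m : ℝ) (n : ℕ) {i j : Fin 4} (hij : i ≠ j) :
    ⟪diracCoeffRaw m (n + 1) i, diracCoeffRaw m (n + 1) j⟫_ℝ = 0 := by
  have hs : Real.sqrt (2 * (n + 1 : ℕ)) ^ 2 = 2 * (n + 1 : ℕ) := Real.sq_sqrt (by positivity)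
  have he := diracEnergy_sq m (n + 1)
  rw [← hs] at he
  rw [PiLp.inner_apply, Fin.sum_univ_four]
  simp only [diracCoeffRaw]
  generalize Real.sqrt (2 * (n + 1 : ℕ)) = s at *
  generalize diracEnergy m (n + 1) = E at *
  fin_cases i <;> fin_cases j <;> simp at hij ⊢ <;>
    first
    | ring1
    | linear_combination 2 * he

lemma diracCoeff_orthonormal (m : ℝ) (n : ℕ) (i j : Fin 4) :
    diracCoeff m (n + 1) i 0 * diracCoeff m (n + 1) j 0
      + diracCoeff m (n + 1) i 1 * diracCoeff m (n + 1) j 1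
      + diracCoeff m (n + 1) i 2 * diracCoeff m (n + 1) j 2
      + diracCoeff m (n + 1) i 3 * diracCoeff m (n + 1) j 3 = if i = j then 1 else 0 := by
  have h1 : ⟪diracCoeff m (n + 1) i, diracCoeff m (n + 1) j⟫_ℝ = if i = j then 1 else 0 := by
    rw [diracCoeff, diracCoeff, real_inner_smul_left, real_inner_smul_right]
    split_ifs with hij
    · subst hij
      have := norm_ne_zero_iff.2 (diracCoeffRaw_ne_zero m n i)
      rw [real_inner_self_eq_norm_sq]
      field_simp
    · rw [diracCoeffRaw_inner m n hij, mul_zero, mul_zero]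
  rw [← h1, PiLp.inner_apply, Fin.sum_univ_four]
  simp only [RCLike.inner_apply, conj_trivial]
  ring

lemma diracCoeff_apply (m : ℝ) (n : ℕ) (j k : Fin 4) :
    diracCoeff m n j k = ‖diracCoeffRaw m n j‖⁻¹ * diracCoeffRaw m n j k := rfl

/-- These are the rows of the level matrix. It is real and symmetric, so the same identities serve
the eigenfunctions and the dual relation. -/
lemma diracCoeff_eigen (m : ℝ) (n : ℕ) (j : Fin 4) :
    (m * diracCoeff m (n + 1) j 2 + Real.sqrt (2 * (n + 1 : ℕ)) * diracCoeff m (n + 1) j 3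
      = diracEigenvalue m (.excited n j) * diracCoeff m (n + 1) j 0) ∧
    (Real.sqrt (2 * (n + 1 : ℕ)) * diracCoeff m (n + 1) j 2 - m * diracCoeff m (n + 1) j 3
      = diracEigenvalue m (.excited n j) * diracCoeff m (n + 1) j 1) ∧
    (m * diracCoeff m (n + 1) j 0 + Real.sqrt (2 * (n + 1 : ℕ)) * diracCoeff m (n + 1) j 1
      = diracEigenvalue m (.excited n j) * diracCoeff m (n + 1) j 2) ∧
    (Real.sqrt (2 * (n + 1 : ℕ)) * diracCoeff m (n + 1) j 0 - m * diracCoeff m (n + 1) j 1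
      = diracEigenvalue m (.excited n j) * diracCoeff m (n + 1) j 3) := by
  have hs : Real.sqrt (2 * (n + 1 : ℕ)) ^ 2 = 2 * (n + 1 : ℕ) := Real.sq_sqrt (by positivity)
  have he := diracEnergy_sq m (n + 1)
  rw [← hs] at he
  simp only [diracCoeff_apply]
  generalize ‖diracCoeffRaw m (n + 1) j‖⁻¹ = r
  simp only [diracCoeffRaw, diracEigenvalue]
  generalize Real.sqrt (2 * (n + 1 : ℕ)) = s at *
  generalize diracEnergy m (n + 1) = E at *
  refine ⟨?_, ?_, ?_, ?_⟩ <;> fin_cases j <;> simp <;>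
    first
    | ring1
    | linear_combination r * he
    | linear_combination -r * he

lemma diracEigenvalue_excited_sq (m : ℝ) (n : ℕ) (j : Fin 4) :
    diracEigenvalue m (.excited n j) ^ 2 = 2 * (n + 1 : ℕ) + m ^ 2 := by
  rw [← diracEnergy_sq]
  fin_cases j <;> simp [diracEigenvalue]

lemma diracEigenvalue_ground_sq (m : ℝ) (s : Fin 2) :
    diracEigenvalue m (.ground s) ^ 2 = m ^ 2 := by
  fin_cases s <;> simp [diracEigenvalue]

lemma inner_diracEigenfun_excited (hθ : |θ| < Real.pi / 2) (m : ℝ) (n : ℕ) (j : Fin 4)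
    (Ψ : L2R4) :
    ⟪diracEigenfun hθ m (.excited n j), Ψ⟫_ℂ
      = diracCoeff m (n + 1) j 0 * ⟪rotHermite hθ (n + 1), Ψ 0⟫_ℂ
        + diracCoeff m (n + 1) j 1 * ⟪rotHermite hθ n, Ψ 1⟫_ℂ
        + diracCoeff m (n + 1) j 2 * ⟪rotHermite hθ (n + 1), Ψ 2⟫_ℂ
        + diracCoeff m (n + 1) j 3 * ⟪rotHermite hθ n, Ψ 3⟫_ℂ := by
  rw [PiLp.inner_apply, Fin.sum_univ_four]
  change ⟪diracCoeff m (n + 1) j 0 • rotHermite hθ (n + 1), Ψ 0⟫_ℂ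
    + ⟪diracCoeff m (n + 1) j 1 • rotHermite hθ n, Ψ 1⟫_ℂ
    + ⟪diracCoeff m (n + 1) j 2 • rotHermite hθ (n + 1), Ψ 2⟫_ℂ
    + ⟪diracCoeff m (n + 1) j 3 • rotHermite hθ n, Ψ 3⟫_ℂ = _
  simp only [real_smul_eq, inner_smul_left, conj_ofReal]

lemma inner_diracEigenfun_ground (hθ : |θ| < Real.pi / 2) (m : ℝ) (s : Fin 2) (Ψ : L2R4) :
    ⟪diracEigenfun hθ m (.ground s), Ψ⟫_ℂ
      = ((Real.sqrt 2)⁻¹ : ℝ) * ⟪rotHermite hθ 0, Ψ 0⟫_ℂ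
        + (![(Real.sqrt 2)⁻¹, -(Real.sqrt 2)⁻¹] s : ℝ) * ⟪rotHermite hθ 0, Ψ 2⟫_ℂ := by
  rw [PiLp.inner_apply, Fin.sum_univ_four]
  change ⟪((Real.sqrt 2)⁻¹ : ℝ) • rotHermite hθ 0, Ψ 0⟫_ℂ + ⟪(0 : L2R), Ψ 1⟫_ℂ
    + ⟪(![(Real.sqrt 2)⁻¹, -(Real.sqrt 2)⁻¹] s : ℝ) • rotHermite hθ 0, Ψ 2⟫_ℂ
    + ⟪(0 : L2R), Ψ 3⟫_ℂ = _
  simp only [real_smul_eq, inner_smul_left, conj_ofReal, inner_zero_left, add_zero]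

lemma diracEigenfun_mem (hθ : |θ| < Real.pi / 2) (m : ℝ) (a : DiracLabel) :
    diracEigenfun hθ m a ∈ diracDomain := by
  have hr : ∀ (r : ℝ) (k : ℕ), r • rotHermite hθ k ∈ formDomain := fun r k => by
    rw [real_smul_eq]; exact formDomain.smul_mem _ (rotHermite_mem hθ k)
  intro k
  cases a with
  | ground s =>
    fin_cases k
    exacts [hr _ _, formDomain.zero_mem, hr _ _, formDomain.zero_mem]
  | excited n j =>
    fin_cases k
    exacts [hr _ _, hr _ _, hr _ _, hr _ _]

lemma lowerOp_smul_rotHermite (hθ : |θ| < Real.pi / 2) (r : ℝ) (n : ℕ) (u : formDomain)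
    (hu : (u : L2R) = r • rotHermite hθ n) :
    lowerOp θ u = ((Real.sqrt (2 * n) * r : ℝ) : ℂ) • rotHermite hθ (n - 1) := by
  have : u = (r : ℂ) • ⟨_, rotHermite_mem hθ n⟩ := Subtype.ext (by
    rw [hu, real_smul_eq]; rfl)
  rw [this, map_smul, lowerOp_rotHermite, smul_smul, ofReal_mul, mul_comm]

lemma raiseOp_smul_rotHermite (hθ : |θ| < Real.pi / 2) (r : ℝ) (n : ℕ) (u : formDomain)
    (hu : (u : L2R) = r • rotHermite hθ n) :
    raiseOp θ u = ((Real.sqrt (2 * (n + 1 : ℕ)) * r : ℝ) : ℂ) • rotHermite hθ (n + 1) := by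
  have : u = (r : ℂ) • ⟨_, rotHermite_mem hθ n⟩ := Subtype.ext (by
    rw [hu, real_smul_eq]; rfl)
  rw [this, map_smul, raiseOp_rotHermite, smul_smul, ofReal_mul, mul_comm]

lemma diracOp_diracEigenfun (hθ : |θ| < Real.pi / 2) (m : ℝ) (a : DiracLabel) :
    diracOp θ m ⟨diracEigenfun hθ m a, diracEigenfun_mem hθ m a⟩
      = (diracEigenvalue m a : ℂ) • diracEigenfun hθ m a := by
  set Ψ : diracDomain := ⟨diracEigenfun hθ m a, diracEigenfun_mem hθ m a⟩ with hΨ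
  have hc : ∀ k, (diracComponent k Ψ : L2R) = diracEigenfun hθ m a k := fun k => rfl
  have h0 := diracOp_apply_zero (θ := θ) (m := m) Ψ
  have h1 := diracOp_apply_one (θ := θ) (m := m) Ψ
  have h2 := diracOp_apply_two (θ := θ) (m := m) Ψ
  have h3 := diracOp_apply_three (θ := θ) (m := m) Ψ
  rw [hc] at h0 h1 h2 h3
  cases a with
  | ground s =>
    have c1 : diracComponent 1 Ψ = 0 := Subtype.ext rfl
    have c3 : diracComponent 3 Ψ = 0 := Subtype.ext rfl
    rw [c3, map_zero, add_zero] at h0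
    -- The lowered index 0 - 1 is meaningless but comes with the coefficient √(2·0) = 0.
    rw [lowerOp_smul_rotHermite hθ _ 0 (diracComponent 2 Ψ) rfl] at h1
    rw [c1, map_zero, add_zero] at h2
    rw [lowerOp_smul_rotHermite hθ _ 0 (diracComponent 0 Ψ) rfl] at h3
    ext1 k
    fin_cases k
    · refine h0.trans ?_
      change (m : ℂ) • ((![(Real.sqrt 2)⁻¹, -(Real.sqrt 2)⁻¹] s : ℝ) • rotHermite hθ 0)
        = (diracEigenvalue m (.ground s) : ℂ) • (((Real.sqrt 2)⁻¹ : ℝ) • rotHermite hθ 0)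
      rw [real_smul_eq, real_smul_eq, smul_smul, smul_smul, ← ofReal_mul, ← ofReal_mul]
      congr 2
      fin_cases s <;> simp [diracEigenvalue]
    · refine h1.trans ?_
      change _ - (m : ℂ) • (0 : L2R) = (diracEigenvalue m (.ground s) : ℂ) • (0 : L2R)
      simp
    · refine h2.trans ?_
      change (m : ℂ) • (((Real.sqrt 2)⁻¹ : ℝ) • rotHermite hθ 0) = (diracEigenvalue m (.ground s) : ℂ)
        • ((![(Real.sqrt 2)⁻¹, -(Real.sqrt 2)⁻¹] s : ℝ) • rotHermite hθ 0)
      rw [real_smul_eq, real_smul_eq, smul_smul, smul_smul, ← ofReal_mul, ← ofReal_mul]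
      congr 2
      fin_cases s <;> simp [diracEigenvalue]
    · refine h3.trans ?_
      change _ - (m : ℂ) • (0 : L2R) = (diracEigenvalue m (.ground s) : ℂ) • (0 : L2R)
      simp
  | excited n j =>
    obtain ⟨e0, e1, e2, e3⟩ := diracCoeff_eigen m n j
    rw [raiseOp_smul_rotHermite hθ _ n (diracComponent 3 Ψ) rfl] at h0
    rw [lowerOp_smul_rotHermite hθ _ (n + 1) (diracComponent 2 Ψ) rfl] at h1
    rw [raiseOp_smul_rotHermite hθ _ n (diracComponent 1 Ψ) rfl] at h2
    rw [lowerOp_smul_rotHermite hθ _ (n + 1) (diracComponent 0 Ψ) rfl] at h3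
    ext1 k
    fin_cases k
    · refine h0.trans ?_
      change (m : ℂ) • (diracCoeff m (n + 1) j 2 • rotHermite hθ (n + 1)) + _
        = (diracEigenvalue m (.excited n j) : ℂ) •
          (diracCoeff m (n + 1) j 0 • rotHermite hθ (n + 1))
      rw [real_smul_eq, real_smul_eq, smul_smul, smul_smul, ← add_smul, ← ofReal_mul,
        ← ofReal_mul, ← ofReal_add, e0]
    · refine h1.trans ?_
      change _ - (m : ℂ) • (diracCoeff m (n + 1) j 3 • rotHermite hθ n)
        = (diracEigenvalue m (.excited n j) : ℂ) • (diracCoeff m (n + 1) j 1 • rotHermite hθ n)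
      rw [real_smul_eq, real_smul_eq, smul_smul, smul_smul, Nat.add_sub_cancel, ← sub_smul,
        ← ofReal_mul, ← ofReal_mul, ← ofReal_sub, e1]
    · refine h2.trans ?_
      change (m : ℂ) • (diracCoeff m (n + 1) j 0 • rotHermite hθ (n + 1)) + _
        = (diracEigenvalue m (.excited n j) : ℂ) •
          (diracCoeff m (n + 1) j 2 • rotHermite hθ (n + 1))
      rw [real_smul_eq, real_smul_eq, smul_smul, smul_smul, ← add_smul, ← ofReal_mul,
        ← ofReal_mul, ← ofReal_add, e2]
    · refine h3.trans ?_
      change _ - (m : ℂ) • (diracCoeff m (n + 1) j 1 • rotHermite hθ n)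
        = (diracEigenvalue m (.excited n j) : ℂ) • (diracCoeff m (n + 1) j 3 • rotHermite hθ n)
      rw [real_smul_eq, real_smul_eq, smul_smul, smul_smul, Nat.add_sub_cancel, ← sub_smul,
        ← ofReal_mul, ← ofReal_mul, ← ofReal_sub, e3]

/-- Each ladder operator is moved to the left factor, where it shifts the Hermite index; collecting
the components of Ψ leaves the rows of the symmetric level matrix. -/
lemma inner_diracEigenfun_diracOp {θ' : ℝ} (hθ' : |θ'| < Real.pi / 2) (h : θ' = -θ) (m : ℝ)
    (a : DiracLabel) (Ψ : diracDomain) :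
    ⟪diracEigenfun hθ' m a, diracOp θ m Ψ⟫_ℂ
      = diracEigenvalue m a * ⟪diracEigenfun hθ' m a, (Ψ : L2R4)⟫_ℂ := by
  have hc : ∀ k, (diracComponent k Ψ : L2R) = (Ψ : L2R4) k := fun k => rfl
  cases a with
  | ground s =>
    rw [inner_diracEigenfun_ground, inner_diracEigenfun_ground, diracOp_apply_zero,
      diracOp_apply_two, inner_add_right, inner_add_right, inner_smul_right, inner_smul_right,
      inner_rotHermite_raiseOp hθ' h, inner_rotHermite_raiseOp hθ' h, hc, hc, hc, hc]
    fin_cases s <;> simp [diracEigenvalue] <;> ring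
  | excited n j =>
    obtain ⟨e0, e1, e2, e3⟩ := diracCoeff_eigen m n j
    rw [inner_diracEigenfun_excited, inner_diracEigenfun_excited, diracOp_apply_zero,
      diracOp_apply_one, diracOp_apply_two, diracOp_apply_three, inner_add_right,
      inner_add_right, inner_sub_right, inner_sub_right, inner_smul_right, inner_smul_right,
      inner_smul_right, inner_smul_right, inner_rotHermite_raiseOp hθ' h,
      inner_rotHermite_raiseOp hθ' h, inner_rotHermite_lowerOp hθ' h,
      inner_rotHermite_lowerOp hθ' h, hc, hc, hc, hc, Nat.add_sub_cancel]
    replace e0 := congrArg ofReal e0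
    replace e1 := congrArg ofReal e1
    replace e2 := congrArg ofReal e2
    replace e3 := congrArg ofReal e3
    simp only [ofReal_add, ofReal_sub, ofReal_mul] at e0 e1 e2 e3
    linear_combination e0 * ⟪rotHermite hθ' (n + 1), (Ψ : L2R4) 0⟫_ℂ
      + e1 * ⟪rotHermite hθ' n, (Ψ : L2R4) 1⟫_ℂ
      + e2 * ⟪rotHermite hθ' (n + 1), (Ψ : L2R4) 2⟫_ℂ
      + e3 * ⟪rotHermite hθ' n, (Ψ : L2R4) 3⟫_ℂ

lemma inner_diracEigenfun_diracEigenfun (hθ : |θ| < Real.pi / 2) {θ' : ℝ}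
    (hθ' : |θ'| < Real.pi / 2) (h : θ' = -θ) (m : ℝ) (a b : DiracLabel) [Decidable (a = b)] :
    ⟪diracEigenfun hθ' m a, diracEigenfun hθ m b⟫_ℂ = if a = b then 1 else 0 := by
  have hf := inner_rotHermite_rotHermite hθ hθ' h
  have h2 : (((Real.sqrt 2)⁻¹ : ℝ) : ℂ) * (((Real.sqrt 2)⁻¹ : ℝ) : ℂ) = 1 / 2 := by
    rw [← ofReal_mul, ← mul_inv, Real.mul_self_sqrt zero_le_two]; norm_num
  cases a with
  | ground s =>
    rw [inner_diracEigenfun_ground]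
    cases b with
    | ground t =>
      have e0 : diracEigenfun hθ m (.ground t) 0 = ((Real.sqrt 2)⁻¹ : ℝ) • rotHermite hθ 0 := rfl
      have e2 : diracEigenfun hθ m (.ground t) 2
        = (![(Real.sqrt 2)⁻¹, -(Real.sqrt 2)⁻¹] t : ℝ) • rotHermite hθ 0 := rfl
      rw [e0, e2, real_smul_eq, real_smul_eq, inner_smul_right, inner_smul_right, hf, if_pos rfl]
      simp only [DiracLabel.ground.injEq]
      fin_cases s <;> fin_cases t <;> simp at h2 ⊢ <;> rw [h2] <;> norm_num
    | excited n j =>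
      have e0 : diracEigenfun hθ m (.excited n j) 0
        = diracCoeff m (n + 1) j 0 • rotHermite hθ (n + 1) := rfl
      have e2 : diracEigenfun hθ m (.excited n j) 2
        = diracCoeff m (n + 1) j 2 • rotHermite hθ (n + 1) := rfl
      rw [e0, e2, real_smul_eq, real_smul_eq, inner_smul_right, inner_smul_right, hf]
      simp
  | excited n i =>
    rw [inner_diracEigenfun_excited]
    cases b with
    | ground t =>
      have e0 : diracEigenfun hθ m (.ground t) 0 = ((Real.sqrt 2)⁻¹ : ℝ) • rotHermite hθ 0 := rfl
      have e1 : diracEigenfun hθ m (.ground t) 1 = 0 := rfl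
      have e2 : diracEigenfun hθ m (.ground t) 2
        = (![(Real.sqrt 2)⁻¹, -(Real.sqrt 2)⁻¹] t : ℝ) • rotHermite hθ 0 := rfl
      have e3 : diracEigenfun hθ m (.ground t) 3 = 0 := rfl
      rw [e0, e1, e2, e3, real_smul_eq, real_smul_eq, inner_smul_right, inner_smul_right, hf]
      simp
    | excited k j =>
      have e0 : diracEigenfun hθ m (.excited k j) 0
        = diracCoeff m (k + 1) j 0 • rotHermite hθ (k + 1) := rfl
      have e1 : diracEigenfun hθ m (.excited k j) 1
        = diracCoeff m (k + 1) j 1 • rotHermite hθ k := rfl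
      have e2 : diracEigenfun hθ m (.excited k j) 2
        = diracCoeff m (k + 1) j 2 • rotHermite hθ (k + 1) := rfl
      have e3 : diracEigenfun hθ m (.excited k j) 3
        = diracCoeff m (k + 1) j 3 • rotHermite hθ k := rfl
      rw [e0, e1, e2, e3]
      simp only [real_smul_eq, inner_smul_right, hf, DiracLabel.excited.injEq, add_left_inj]
      by_cases hnk : n = k
      · subst hnk
        simp only [true_and, if_true, mul_one]
        have := congrArg ofReal (diracCoeff_orthonormal m n i j)
        simp only [ofReal_add, ofReal_mul] at this
        rw [this]
        split_ifs <;> simp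
      · simp [hnk]

/-- The explicit eigenfunctions are total in `L²(ℝ)⁴`. -/
lemma eq_zero_of_inner_diracEigenfun_eq_zero (hθ : |θ| < Real.pi / 2) (m : ℝ) {Ψ : L2R4}
    (h : ∀ a, ⟪diracEigenfun hθ m a, Ψ⟫_ℂ = 0) : Ψ = 0 := by
  have hexc : ∀ n, ⟪rotHermite hθ (n + 1), Ψ 0⟫_ℂ = 0 ∧ ⟪rotHermite hθ n, Ψ 1⟫_ℂ = 0 ∧
      ⟪rotHermite hθ (n + 1), Ψ 2⟫_ℂ = 0 ∧ ⟪rotHermite hθ n, Ψ 3⟫_ℂ = 0 := by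
    intro n
    have hraw : ∀ j, (diracCoeffRaw m (n + 1) j 0 : ℂ) * ⟪rotHermite hθ (n + 1), Ψ 0⟫_ℂ
        + diracCoeffRaw m (n + 1) j 1 * ⟪rotHermite hθ n, Ψ 1⟫_ℂ
        + diracCoeffRaw m (n + 1) j 2 * ⟪rotHermite hθ (n + 1), Ψ 2⟫_ℂ
        + diracCoeffRaw m (n + 1) j 3 * ⟪rotHermite hθ n, Ψ 3⟫_ℂ = 0 := by
      intro j
      have h1 := h (.excited n j)
      rw [inner_diracEigenfun_excited] at h1
      simp only [diracCoeff_apply, ofReal_mul] at h1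
      have hne : ((‖diracCoeffRaw m (n + 1) j‖⁻¹ : ℝ) : ℂ) ≠ 0 := by
        rw [ofReal_ne_zero]
        exact inv_ne_zero (norm_ne_zero_iff.2 (diracCoeffRaw_ne_zero m n j))
      refine mul_left_cancel₀ hne ?_
      rw [mul_zero, ← h1]
      ring
    generalize ⟪rotHermite hθ (n + 1), Ψ 0⟫_ℂ = w0 at *
    generalize ⟪rotHermite hθ n, Ψ 1⟫_ℂ = w1 at *
    generalize ⟪rotHermite hθ (n + 1), Ψ 2⟫_ℂ = w2 at *
    generalize ⟪rotHermite hθ n, Ψ 3⟫_ℂ = w3 at *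
    have hs : ((Real.sqrt (2 * (n + 1 : ℕ)) : ℝ) : ℂ) ≠ 0 := by
      rw [ofReal_ne_zero]; positivity
    have hE : ((diracEnergy m (n + 1) : ℝ) : ℂ) ≠ 0 := by
      rw [ofReal_ne_zero, diracEnergy]; positivity
    have r0 := hraw 0
    have r1 := hraw 1
    have r2 := hraw 2
    have r3 := hraw 3
    simp only [diracCoeffRaw] at r0 r1 r2 r3
    generalize Real.sqrt (2 * (n + 1 : ℕ)) = s at *
    generalize diracEnergy m (n + 1) = E at *
    simp at r0 r1 r2 r3
    -- Signed sums of the four equations isolate E·w1 and E·w3, then s·w0 and s·w2; E and s are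
    -- nonzero, which shows the coefficient matrix to be invertible.
    have k1 : (E : ℂ) * w1 = 0 := by linear_combination (r0 + r1 + r2 + r3) / 4
    have k3 : (E : ℂ) * w3 = 0 := by linear_combination (r0 - r1 + r2 - r3) / 4
    have w1z := (mul_eq_zero.1 k1).resolve_left hE
    have w3z := (mul_eq_zero.1 k3).resolve_left hE
    subst w1z w3z
    have k0 : (s : ℂ) * w0 = 0 := by linear_combination (r0 + r3) / 2
    have k2 : (s : ℂ) * w2 = 0 := by linear_combination (r0 - r3) / 2
    exact ⟨(mul_eq_zero.1 k0).resolve_left hs, rfl, (mul_eq_zero.1 k2).resolve_left hs, rfl⟩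
  have hgr : ⟪rotHermite hθ 0, Ψ 0⟫_ℂ = 0 ∧ ⟪rotHermite hθ 0, Ψ 2⟫_ℂ = 0 := by
    have h0 := h (.ground 0)
    have h1 := h (.ground 1)
    rw [inner_diracEigenfun_ground] at h0 h1
    have hr : (((Real.sqrt 2)⁻¹ : ℝ) : ℂ) ≠ 0 := by rw [ofReal_ne_zero]; positivity
    generalize (Real.sqrt 2)⁻¹ = r at *
    simp at h0 h1
    refine ⟨mul_left_cancel₀ hr ?_, mul_left_cancel₀ hr ?_⟩
    · linear_combination (h0 + h1) / 2
    · linear_combination (h0 - h1) / 2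
  have hk : ∀ k, Ψ k = 0 := by
    intro k
    refine eq_zero_of_inner_rotHermite_eq_zero hθ fun n => ?_
    fin_cases k
    · cases n with
      | zero => exact hgr.1
      | succ n => exact (hexc n).1
    · exact (hexc n).2.1
    · cases n with
      | zero => exact hgr.2
      | succ n => exact (hexc n).2.2.1
    · exact (hexc n).2.2.2
  ext1 k
  exact hk k

end Dirac

/-! ### The spectrum of the Dirac operator -/

section DiracSpectrum

open Filter Topology

variable {θ m : ℝ}

lemma tendsto_apply {Ψ : ℕ → L2R4} {v : L2R4} (h : Tendsto Ψ atTop (𝓝 v)) (k : Fin 4) :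
    Tendsto (fun n => Ψ n k) atTop (𝓝 (v k)) :=
  ((PiLp.continuous_ofLp 2 fun _ : Fin 4 => L2R).tendsto v |>.comp h).apply_nhds k

/-- Each row is one ladder operator plus a bounded term, so convergence of Ψₖ and of its image
isolates convergence of each ladder operator, and these are closed. -/
lemma diracOp_closed (hθ : |θ| < Real.pi / 2) (m : ℝ) (Ψ : ℕ → diracDomain)
    (v y : L2R4) (hv : Tendsto (fun k => (Ψ k : L2R4)) atTop (𝓝 v))
    (hy : Tendsto (fun k => diracOp θ m (Ψ k)) atTop (𝓝 y)) :
    ∃ h : v ∈ (diracOp θ m).domain, diracOp θ m ⟨v, h⟩ = y := by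
  have t : ∀ j, Tendsto (fun k => (diracComponent j (Ψ k) : L2R)) atTop (𝓝 (v j)) :=
    fun j => tendsto_apply hv j
  have s := fun j => tendsto_apply hy j
  obtain ⟨h3, e3⟩ := exists_raiseOp_eq_of_tendsto hθ (t 3)
    (((s 0).sub ((t 2).const_smul (m : ℂ))).congr fun k => by
      rw [diracOp_apply_zero, add_sub_cancel_left])
  obtain ⟨h2, e2⟩ := exists_lowerOp_eq_of_tendsto hθ (t 2)
    (((s 1).add ((t 3).const_smul (m : ℂ))).congr fun k => by
      rw [diracOp_apply_one, sub_add_cancel])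
  obtain ⟨h1, e1⟩ := exists_raiseOp_eq_of_tendsto hθ (t 1)
    (((s 2).sub ((t 0).const_smul (m : ℂ))).congr fun k => by
      rw [diracOp_apply_two, add_sub_cancel_left])
  obtain ⟨h0, e0⟩ := exists_lowerOp_eq_of_tendsto hθ (t 0)
    (((s 3).add ((t 1).const_smul (m : ℂ))).congr fun k => by
      rw [diracOp_apply_three, sub_add_cancel])
  have hmem : v ∈ diracDomain := by
    intro k
    fin_cases k
    exacts [h0, h1, h2, h3]
  refine ⟨hmem, ?_⟩
  have c0 : diracComponent 0 ⟨v, hmem⟩ = ⟨v 0, h0⟩ := rfl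
  have c1 : diracComponent 1 ⟨v, hmem⟩ = ⟨v 1, h1⟩ := rfl
  have c2 : diracComponent 2 ⟨v, hmem⟩ = ⟨v 2, h2⟩ := rfl
  have c3 : diracComponent 3 ⟨v, hmem⟩ = ⟨v 3, h3⟩ := rfl
  ext1 k
  fin_cases k
  · refine (diracOp_apply_zero ⟨v, hmem⟩).trans ?_
    rw [c2, c3, e3]
    exact add_sub_cancel _ _
  · refine (diracOp_apply_one ⟨v, hmem⟩).trans ?_
    rw [c2, c3, e2]
    exact add_sub_cancel_right _ _
  · refine (diracOp_apply_two ⟨v, hmem⟩).trans ?_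
    rw [c0, c1, e1]
    exact add_sub_cancel _ _
  · refine (diracOp_apply_three ⟨v, hmem⟩).trans ?_
    rw [c0, c1, e0]
    exact add_sub_cancel_right _ _

/-- The form norms of the components are controlled by the graph norm. -/
lemma norm_raiseOp_zero_diracComponent_le (hθ : |θ| < Real.pi / 2) {M : ℝ} {Ψ : diracDomain}
    (h1 : ‖(Ψ : L2R4)‖ ≤ 1) (hM : ‖diracOp θ m Ψ‖ ≤ M) (k : Fin 4) :
    ‖raiseOp 0 (diracComponent k Ψ)‖ ≤ 1 + ((M + |m|) ^ 2 + 1) / (1 - |Real.sin θ|) := by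
  have hK := one_sub_abs_sin_pos hθ
  have hc : ∀ j, ‖(diracComponent j Ψ : L2R)‖ ≤ 1 := fun j =>
    (PiLp.norm_apply_le (Ψ : L2R4) j).trans h1
  have hT : ∀ j, ‖(diracOp θ m Ψ) j‖ ≤ M := fun j => (PiLp.norm_apply_le _ j).trans hM
  have hmc : ∀ j, ‖(m : ℂ) • (diracComponent j Ψ : L2R)‖ ≤ |m| := fun j => by
    rw [norm_smul, norm_real, Real.norm_eq_abs]
    exact mul_le_of_le_one_right (abs_nonneg m) (hc j)
  have low : ∀ j (y y' : L2R), lowerOp θ (diracComponent j Ψ) = y + y' → ‖y‖ ≤ M → ‖y'‖ ≤ |m| →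
      ‖raiseOp 0 (diracComponent j Ψ)‖ ≤ 1 + ((M + |m|) ^ 2 + 1) / (1 - |Real.sin θ|) := by
    intro j y y' he hy hy'
    refine norm_raiseOp_zero_le hK ((coercive_lowerOp θ _).trans (add_le_add ?_ ?_))
    · rw [he]
      exact pow_le_pow_left₀ (norm_nonneg _) ((norm_add_le _ _).trans (add_le_add hy hy')) 2
    · exact pow_le_one₀ (norm_nonneg _) (hc j)
  have up : ∀ j (y y' : L2R), raiseOp θ (diracComponent j Ψ) = y - y' → ‖y‖ ≤ M → ‖y'‖ ≤ |m| →
      ‖raiseOp 0 (diracComponent j Ψ)‖ ≤ 1 + ((M + |m|) ^ 2 + 1) / (1 - |Real.sin θ|) := by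
    intro j y y' he hy hy'
    refine norm_raiseOp_zero_le hK ((coercive_raiseOp θ _).trans (add_le_add ?_ ?_))
    · rw [he]
      exact pow_le_pow_left₀ (norm_nonneg _) ((norm_sub_le _ _).trans (add_le_add hy hy')) 2
    · exact pow_le_one₀ (norm_nonneg _) (hc j)
  -- Each component stands under a ladder operator in exactly one row: component k in row 3 - k.
  fin_cases k
  · exact low 0 _ _ (by rw [diracOp_apply_three Ψ, sub_add_cancel]) (hT 3) (hmc 1)
  · exact up 1 _ _ (by rw [diracOp_apply_two Ψ, add_sub_cancel_left]) (hT 2) (hmc 0)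
  · exact low 2 _ _ (by rw [diracOp_apply_one Ψ, sub_add_cancel]) (hT 1) (hmc 3)
  · exact up 3 _ _ (by rw [diracOp_apply_zero Ψ, add_sub_cancel_left]) (hT 0) (hmc 2)

/-- A graph-norm bound places all four components in one totally bounded set; the product of the
compact closures is compact. -/
lemma diracOp_compact (hθ : |θ| < Real.pi / 2) (m : ℝ) (Ψ : ℕ → (diracOp θ m).domain) (M : ℝ)
    (h1 : ∀ k, ‖(Ψ k : L2R4)‖ ≤ 1) (hM : ∀ k, ‖diracOp θ m (Ψ k)‖ ≤ M) :
    ∃ (v : L2R4) (φ : ℕ → ℕ), StrictMono φ ∧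
      Tendsto (fun k => (Ψ (φ k) : L2R4)) atTop (𝓝 v) := by
  have hB := totallyBounded_formDomain (1 + ((M + |m|) ^ 2 + 1) / (1 - |Real.sin θ|))
  set S := {v : L2R | ∃ u : formDomain, (u : L2R) = v ∧ ‖v‖ ≤ 1 ∧
    ‖raiseOp 0 u‖ ≤ 1 + ((M + |m|) ^ 2 + 1) / (1 - |Real.sin θ|)}
  have hS : IsCompact (closure S) :=
    isCompact_iff_totallyBounded_isComplete.2 ⟨hB.closure, isClosed_closure.isComplete⟩
  have hS4 : IsCompact (WithLp.toLp 2 '' Set.pi Set.univ fun _ : Fin 4 => closure S) :=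
    (isCompact_univ_pi fun _ => hS).image (PiLp.continuous_toLp 2 fun _ : Fin 4 => L2R)
  obtain ⟨v, -, φ, hφ, hv⟩ := hS4.tendsto_subseq (x := fun k => (Ψ k : L2R4)) fun k => by
    refine ⟨WithLp.ofLp (Ψ k : L2R4), fun j _ => subset_closure ?_, rfl⟩
    exact ⟨diracComponent j (Ψ k), rfl, (PiLp.norm_apply_le (Ψ k : L2R4) j).trans (h1 k),
      norm_raiseOp_zero_diracComponent_le hθ (h1 k) (hM k) j⟩
  exact ⟨v, φ, hφ, hv⟩

/-- The square 2(n+1) + m² determines the level, so a fibre meets at most one excited level, besides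
the two ground labels. -/
lemma finite_diracEigenvalue_fiber (m : ℝ) (z : ℂ) :
    {a : DiracLabel | (diracEigenvalue m a : ℂ) = z}.Finite := by
  have hg : (Set.range DiracLabel.ground).Finite := Set.finite_range _
  have he : ∀ n, (Set.range (DiracLabel.excited n)).Finite := fun n => Set.finite_range _
  by_cases h : ∃ n j, (diracEigenvalue m (.excited n j) : ℂ) = z
  · obtain ⟨n, j, rfl⟩ := h
    refine (hg.union (he n)).subset ?_
    rintro (s | ⟨k, i⟩) ha
    · exact Or.inl ⟨s, rfl⟩
    · right
      rw [Set.mem_ofPred_eq, ofReal_inj] at ha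
      have h1 := diracEigenvalue_excited_sq m k i
      rw [ha, diracEigenvalue_excited_sq] at h1
      have h2 : (n : ℝ) = k := by push_cast at h1; linarith
      rw [Nat.cast_inj.1 h2]
      exact ⟨i, rfl⟩
  · refine hg.subset ?_
    rintro (s | ⟨k, i⟩) ha
    · exact ⟨s, rfl⟩
    · exact absurd ⟨k, i, ha⟩ h

lemma diracOp_eigensystem (hθ : |θ| < Real.pi / 2) (m : ℝ) :
    BiorthonormalEigensystem (diracOp θ m) (fun a => (diracEigenvalue m a : ℂ))
      (diracEigenfun hθ m) (diracEigenfunTilde hθ m) := by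
  classical
  exact
  { eigen := fun a => ⟨diracEigenfun_mem hθ m a, diracOp_diracEigenfun hθ m a⟩
    dual := fun a u => inner_diracEigenfun_diracOp _ rfl m a u
    biorth_self := fun a =>
      (inner_diracEigenfun_diracEigenfun hθ _ rfl m a a).trans (if_pos rfl)
    biorth_ne := fun a b hab =>
      (inner_diracEigenfun_diracEigenfun hθ _ rfl m a b).trans (if_neg hab)
    total := fun _ hu => eq_zero_of_inner_diracEigenfun_eq_zero hθ m hu
    total_dual := fun _ hu => eq_zero_of_inner_diracEigenfun_eq_zero _ m hu
    finite_fiber := finite_diracEigenvalue_fiber m }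

/-! ### Range and fibres of the eigenvalue map -/

lemma range_diracEigenvalue (hm : 0 ≤ m) :
    Set.range (fun a => (diracEigenvalue m a : ℂ)) =
      {z : ℂ | ∃ n : ℕ, z = (Real.sqrt (2 * n + m ^ 2) : ℝ) ∨
        z = (-Real.sqrt (2 * n + m ^ 2) : ℝ)} := by
  have h0 : Real.sqrt (2 * (0 : ℕ) + m ^ 2) = m := by
    rw [Nat.cast_zero, mul_zero, zero_add, Real.sqrt_sq hm]
  ext z
  constructor
  · rintro ⟨s | ⟨n, j⟩, rfl⟩
    · refine ⟨0, ?_⟩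
      rw [h0]
      fin_cases s
      exacts [Or.inl rfl, Or.inr rfl]
    · refine ⟨n + 1, ?_⟩
      fin_cases j
      exacts [Or.inl rfl, Or.inl rfl, Or.inr rfl, Or.inr rfl]
  · rintro ⟨n, rfl | rfl⟩
    · cases n with
      | zero => rw [h0]; exact ⟨.ground 0, rfl⟩
      | succ n => exact ⟨.excited n 0, rfl⟩
    · cases n with
      | zero => rw [h0]; exact ⟨.ground 1, rfl⟩
      | succ n => exact ⟨.excited n 2, rfl⟩

lemma diracEigenvalue_ground_sq_ne (m : ℝ) (s : Fin 2) (n : ℕ) {x : ℝ}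
    (hx : x ^ 2 = 2 * (n + 1 : ℕ) + m ^ 2) : diracEigenvalue m (.ground s) ≠ x := by
  rintro rfl
  rw [diracEigenvalue_ground_sq] at hx
  have : (0 : ℝ) < 2 * (n + 1 : ℕ) := by positivity
  linarith

lemma eq_of_diracEigenvalue_excited_eq {n k : ℕ} {j : Fin 4} {x : ℝ}
    (hx : x ^ 2 = 2 * (n + 1 : ℕ) + m ^ 2) (h : diracEigenvalue m (.excited k j) = x) : k = n := by
  rw [← h, diracEigenvalue_excited_sq] at hx
  have h2 : (k : ℝ) = n := by push_cast at hx; linarith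
  exact Nat.cast_inj.1 h2

lemma fiber_energy (m : ℝ) (n : ℕ) :
    {a | (diracEigenvalue m a : ℂ) = (Real.sqrt (2 * (n + 1 : ℕ) + m ^ 2) : ℝ)}
      = {DiracLabel.excited n 0, DiracLabel.excited n 1} := by
  have hE : 0 < diracEnergy m (n + 1) := Real.sqrt_pos.2 (by positivity)
  have hne : -diracEnergy m (n + 1) ≠ diracEnergy m (n + 1) := by linarith
  change {a | (diracEigenvalue m a : ℂ) = (diracEnergy m (n + 1) : ℝ)} = _
  ext a
  simp only [Set.mem_ofPred_eq, ofReal_inj, Set.mem_insert_iff, Set.mem_singleton_iff]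
  constructor
  · intro h
    rcases a with s | ⟨k, j⟩
    · exact absurd h (diracEigenvalue_ground_sq_ne m s n (diracEnergy_sq m (n + 1)))
    · obtain rfl := eq_of_diracEigenvalue_excited_eq (diracEnergy_sq m (n + 1)) h
      fin_cases j
      exacts [Or.inl rfl, Or.inr rfl, absurd h hne, absurd h hne]
  · rintro (rfl | rfl) <;> rfl

lemma fiber_neg_energy (m : ℝ) (n : ℕ) :
    {a | (diracEigenvalue m a : ℂ) = (-Real.sqrt (2 * (n + 1 : ℕ) + m ^ 2) : ℝ)}
      = {DiracLabel.excited n 2, DiracLabel.excited n 3} := by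
  have hE : 0 < diracEnergy m (n + 1) := Real.sqrt_pos.2 (by positivity)
  have hne : diracEnergy m (n + 1) ≠ -diracEnergy m (n + 1) := by linarith
  have hsq : (-diracEnergy m (n + 1)) ^ 2 = 2 * (n + 1 : ℕ) + m ^ 2 := by
    rw [neg_sq, diracEnergy_sq]
  change {a | (diracEigenvalue m a : ℂ) = (-diracEnergy m (n + 1) : ℝ)} = _
  ext a
  simp only [Set.mem_ofPred_eq, ofReal_inj, Set.mem_insert_iff, Set.mem_singleton_iff]
  constructor
  · intro h
    rcases a with s | ⟨k, j⟩
    · exact absurd h (diracEigenvalue_ground_sq_ne m s n hsq)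
    · obtain rfl := eq_of_diracEigenvalue_excited_eq hsq h
      fin_cases j
      exacts [absurd h hne, absurd h hne, Or.inl rfl, Or.inr rfl]
  · rintro (rfl | rfl) <;> rfl

lemma diracEigenvalue_excited_ne (m : ℝ) (n : ℕ) (j : Fin 4) {x : ℝ} (hx : x ^ 2 = m ^ 2) :
    diracEigenvalue m (.excited n j) ≠ x := by
  rintro rfl
  rw [diracEigenvalue_excited_sq] at hx
  have : (0 : ℝ) < 2 * (n + 1 : ℕ) := by positivity
  linarith

/-- Positivity of m separates the two ground labels; for m = 0 they merge, which accounts for the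
double eigenvalue 0. -/
lemma fiber_mass (hm : 0 < m) : {a | (diracEigenvalue m a : ℂ) = m} = {DiracLabel.ground 0} := by
  ext a
  simp only [Set.mem_ofPred_eq, ofReal_inj, Set.mem_singleton_iff]
  constructor
  · intro h
    rcases a with s | ⟨k, j⟩
    · fin_cases s
      · rfl
      · have : -m = m := h
        linarith
    · exact absurd h (diracEigenvalue_excited_ne m k j rfl)
  · rintro rfl; rfl

lemma fiber_neg_mass (hm : 0 < m) :
    {a | (diracEigenvalue m a : ℂ) = (-m : ℝ)} = {DiracLabel.ground 1} := by
  ext a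
  simp only [Set.mem_ofPred_eq, ofReal_inj, Set.mem_singleton_iff]
  constructor
  · intro h
    rcases a with s | ⟨k, j⟩
    · fin_cases s
      · have : m = -m := h
        linarith
      · rfl
    · exact absurd h (diracEigenvalue_excited_ne m k j (neg_sq m))
  · rintro rfl; rfl

lemma fiber_zero :
    {a | (diracEigenvalue 0 a : ℂ) = 0} = {DiracLabel.ground 0, DiracLabel.ground 1} := by
  ext a
  simp only [Set.mem_ofPred_eq, ofReal_eq_zero, Set.mem_insert_iff, Set.mem_singleton_iff]
  constructor
  · intro h
    rcases a with s | ⟨k, j⟩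
    · fin_cases s
      exacts [Or.inl rfl, Or.inr rfl]
    · exact absurd h (diracEigenvalue_excited_ne 0 k j rfl)
  · rintro (rfl | rfl) <;> simp [diracEigenvalue]

end DiracSpectrum

theorem mainTheorem5 (θ m : ℝ) (hθ : |θ| < Real.pi / 2) (hm : 0 ≤ m) :
    -- the spectrum
    unboundedSpectrum (diracOp θ m) =
      {z : ℂ | ∃ n : ℕ, z = (Real.sqrt (2 * n + m ^ 2) : ℝ) ∨
        z = (-Real.sqrt (2 * n + m ^ 2) : ℝ)} ∧
    -- explicit eigenfunctions
    (∀ a : DiracLabel, ∃ h : diracEigenfun hθ m a ∈ (diracOp θ m).domain,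
      diracOp θ m ⟨diracEigenfun hθ m a, h⟩ =
        (diracEigenvalue m a : ℂ) • diracEigenfun hθ m a) ∧
    -- they span the eigenspaces
    (∀ z : ℂ, eigenspaceOf (diracOp θ m) z =
      Submodule.span ℂ {Ψ | ∃ a : DiracLabel,
        (diracEigenvalue m a : ℂ) = z ∧ Ψ = diracEigenfun hθ m a}) ∧
    -- multiplicities
    (∀ n : ℕ, 1 ≤ n →
      geomMultiplicity (diracOp θ m) (Real.sqrt (2 * n + m ^ 2) : ℝ) = 2 ∧
      geomMultiplicity (diracOp θ m) (-Real.sqrt (2 * n + m ^ 2) : ℝ) = 2) ∧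
    (0 < m → geomMultiplicity (diracOp θ m) m = 1 ∧
      geomMultiplicity (diracOp θ m) (-m : ℝ) = 1) ∧
    (m = 0 → geomMultiplicity (diracOp θ m) 0 = 2) ∧
    -- semisimplicity
    (∀ z ∈ unboundedSpectrum (diracOp θ m),
      rootSubspace (diracOp θ m) z = eigenspaceOf (diracOp θ m) z ∧
      algMultiplicity (diracOp θ m) z = geomMultiplicity (diracOp θ m) z) ∧
    -- the same functions with `-θ` are eigenfunctions of `H_{-θ}`, biorthonormal to the first
    (∀ a : DiracLabel, ∃ h : diracEigenfunTilde hθ m a ∈ (diracOp (-θ) m).domain,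
      diracOp (-θ) m ⟨diracEigenfunTilde hθ m a, h⟩ =
        (diracEigenvalue m a : ℂ) • diracEigenfunTilde hθ m a) ∧
    (∀ a : DiracLabel, ⟪diracEigenfunTilde hθ m a, diracEigenfun hθ m a⟫_ℂ = 1) ∧
    (∀ a b : DiracLabel, a ≠ b →
      ⟪diracEigenfunTilde hθ m a, diracEigenfun hθ m b⟫_ℂ = 0) := by
  have hsys := diracOp_eigensystem hθ m
  have hθ' : |(-θ)| < Real.pi / 2 := by rwa [abs_neg]
  refine ⟨?_, hsys.eigen, fun z => ?_, fun n hn => ?_, fun hm0 => ⟨?_, ?_⟩, fun hm0 => ?_,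
    fun z _ => ⟨hsys.rootSubspace_eq z, hsys.algMultiplicity_eq z⟩,
    fun a => ⟨diracEigenfun_mem hθ' m a, diracOp_diracEigenfun hθ' m a⟩,
    hsys.biorth_self, hsys.biorth_ne⟩
  · rw [hsys.unboundedSpectrum_eq (diracOp_closed hθ m) (diracOp_compact hθ m),
      range_diracEigenvalue hm]
  · rw [hsys.eigenspaceOf_eq]
    congr 1
    ext Ψ
    exact exists_congr fun a => and_congr_right fun _ => eq_comm
  -- Labels count excited levels from 0, so level n ≥ 1 is rewritten as a successor.
  · obtain ⟨n, rfl⟩ := Nat.exists_eq_add_of_le' hn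
    exact ⟨hsys.geomMultiplicity_eq_of_fiber_eq_pair (by simp) (fiber_energy m n),
      hsys.geomMultiplicity_eq_of_fiber_eq_pair (by simp) (fiber_neg_energy m n)⟩
  · exact hsys.geomMultiplicity_eq_of_fiber_eq_singleton (fiber_mass hm0)
  · exact hsys.geomMultiplicity_eq_of_fiber_eq_singleton (fiber_neg_mass hm0)
  · subst hm0
    exact hsys.geomMultiplicity_eq_of_fiber_eq_pair (by simp) fiber_zero
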